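/- All Banach and Hilbert spaces are over the same field $\mathbb K\in\{\mathbb R,\mathbb C\}$. For $0<s\le 1$, an operator $T\in L(X,Y)$ between Banach spaces is called $s$-nuclear, $T\in N_s(X,Y)$, if $Tx=\sum_{k=1}^\infty\langle x_k',x\rangle y_k$ for all $x\in X$, with $x_k'\in X^*$, $y_k\in Y$ and $\sum_k\|x_k'\|^s\|y_k\|^s<\infty$; $\nu_s(T)$ is the infimum of $\bigl(\sum_k\|x_k'\|^s\|y_k\|^s\bigr)^{1/s}$ over all such representations. For a Hilbert space $H$ and $0<p<\infty$, $S_p(H)$ is the class of compact operators $U$ on $H$ whose singular numbers $(\mu_j)$ satisfy $\sigma_p(U)=\bigl(\sum_j\mu_j^p\bigr)^{1/p}<\infty$; $S_\infty(H)$ is the class of all compact operators on $H$, with $\sigma_\infty(U)=\|U\|$. An operator $T\in L(X,Y)$ factors through an operator from $S_p(H)$ if $T=BUA$ with $A\in L(X,H)$, $U\in S_p(H)$, $B\in L(H,Y)$; then $\gamma_{S_p}(T)=\inf\|A\|\,\sigma_p(U)\,\|B\|$ over all such factorizations. **Theorem.** Let $n\ge 1$, let $s_1,\dots,s_n\in(0,1]$,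 and let $r\in(0,\infty]$ be given by $$\frac1r=\frac1{s_1}+\dots+\frac1{s_n}-\frac{n+1}{2}$$ (so $r=\infty$ only for $n=1$, $s_1=1$). 1. Let $H$ be any infinite-dimensional Hilbert space. If $X_1,\dots,X_{n+1}$ are Banach spaces and $T_k\in N_{s_k}(X_k,X_{k+1})$ for $k=1,\dots,n$, then the product $T=T_nT_{n-1}\cdots T_1$ factors through an operator from $S_r(H)$, and $$\gamma_{S_r}(T)\le\prod_{k=1}^n\nu_{s_k}(T_k).$$ 2. The exponent $r$ is sharp: there are Banach spaces $X_1,\dots,X_{n+1}$ and operators $T_k\in N_{s_k}(X_k,X_{k+1})$, $k=1,\dots,n$, such that for every $p$ with $0<p<r$ and every Hilbert space $H$ the product $T_nT_{n-1}\cdots T_1$ does not factor through an operator from $S_p(H)$. -/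

import Mathlib

open scoped ENNReal

universe u v

noncomputable section

section Nuclear

variable {𝕜 : Type*} [RCLike 𝕜] {X Y : Type*}
  [NormedAddCommGroup X] [NormedSpace 𝕜 X] [NormedAddCommGroup Y] [NormedSpace 𝕜 Y]

/-- `T x = ∑ₖ ⟨x'ₖ, x⟩ yₖ` for all `x`, with `∑ₖ ‖x'ₖ‖ ^ s * ‖yₖ‖ ^ s < ∞`. -/
def IsNuclearRepr (s : ℝ) (T : X →L[𝕜] Y) (x' : ℕ → (X →L[𝕜] 𝕜)) (y : ℕ → Y) : Prop :=
  Summable (fun k => ‖x' k‖ ^ s * ‖y k‖ ^ s) ∧ ∀ x, HasSum (fun k => x' k x • y k) (T x)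

/-- `T ∈ N_s(X, Y)`. -/
def IsSNuclear (s : ℝ) (T : X →L[𝕜] Y) : Prop :=
  ∃ x' y, IsNuclearRepr s T x' y

/-- The quasinorm `ν_s(T)`. -/
def nuclearQuasinorm (s : ℝ) (T : X →L[𝕜] Y) : ℝ :=
  sInf {c | ∃ x' y, IsNuclearRepr s T x' y ∧ c = (∑' k, ‖x' k‖ ^ s * ‖y k‖ ^ s) ^ (1 / s)}

end Nuclear

section Schatten

variable {𝕜 : Type*} [RCLike 𝕜] {H : Type*} [NormedAddCommGroup H] [InnerProductSpace 𝕜 H]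

/-- The positive terms of `μ` are the singular numbers of `U`, each repeated according to its
multiplicity, that is, `U = ∑ₙ μₙ ⟨eₙ, ·⟩ fₙ` is a canonical (Schmidt) decomposition: the `eₙ`
with `μₙ > 0` form an orthonormal system, and so do the `fₙ`. The sequence may be padded with
zeros (always so if `U` has finite rank) and need not be ordered. -/
def IsSingularSeq (U : H →L[𝕜] H) (μ : ℕ → ℝ) : Prop :=
  (∀ n, 0 ≤ μ n) ∧ ∃ e f : ℕ → H,
    Orthonormal 𝕜 (fun n : {n // 0 < μ n} => e n) ∧
    Orthonormal 𝕜 (fun n : {n // 0 < μ n} => f n) ∧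
    ∀ x, HasSum (fun n => ((μ n : 𝕜) * inner 𝕜 (e n) x) • f n) (U x)

/-- `U ∈ S_p(H)` for `0 < p ≤ ∞`: `U` is compact and, if `p < ∞`, its singular numbers are
`p`-summable. So `S_∞(H)` is the space of all compact operators. -/
def MemSchatten (p : ℝ≥0∞) (U : H →L[𝕜] H) : Prop :=
  IsCompactOperator U ∧
    (p ≠ ⊤ → ∃ μ, IsSingularSeq U μ ∧ Summable (fun n => μ n ^ p.toReal))

open Classical in
/-- The quasinorm `σ_p(U) = (∑ₙ μₙ ^ p) ^ (1 / p)` of `U ∈ S_p(H)` (the operator norm if `p = ∞`).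
The positive singular numbers with their multiplicities are determined by `U`, so the infimum
is over a one-point set. -/
def schattenNorm (p : ℝ≥0∞) (U : H →L[𝕜] H) : ℝ :=
  if p = ⊤ then ‖U‖ else
    sInf {c | ∃ μ, IsSingularSeq U μ ∧ Summable (fun n => μ n ^ p.toReal) ∧
      c = (∑' n, μ n ^ p.toReal) ^ (1 / p.toReal)}

end Schatten

section Factorization

variable {𝕜 : Type*} [RCLike 𝕜] {X Y : Type*}
  [NormedAddCommGroup X] [NormedSpace 𝕜 X] [NormedAddCommGroup Y] [NormedSpace 𝕜 Y]
  (H : Type*) [NormedAddCommGroup H] [InnerProductSpace 𝕜 H]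

/-- `T = B U A` with bounded `A : X → H`, `B : H → Y` and `U ∈ S_p(H)`. -/
def IsSchattenFactorization (p : ℝ≥0∞) (T : X →L[𝕜] Y)
    (A : X →L[𝕜] H) (U : H →L[𝕜] H) (B : H →L[𝕜] Y) : Prop :=
  MemSchatten p U ∧ T = B ∘L U ∘L A

/-- `T` factors through an operator from `S_p(H)`. -/
def FactorsThroughSchatten (p : ℝ≥0∞) (T : X →L[𝕜] Y) : Prop :=
  ∃ A U B, IsSchattenFactorization H p T A U B

/-- `γ_{S_p}(T) = inf ‖A‖ σ_p(U) ‖B‖` over all factorizations `T = B U A` with `U ∈ S_p(H)`. -/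
def schattenFactorNorm (p : ℝ≥0∞) (T : X →L[𝕜] Y) : ℝ :=
  sInf {c | ∃ A U B, IsSchattenFactorization H p T A U B ∧ c = ‖A‖ * schattenNorm p U * ‖B‖}

end Factorization

section Product

variable {𝕜 : Type*} [RCLike 𝕜] {n : ℕ} {X : Fin (n + 1) → Type*}
  [∀ i, NormedAddCommGroup (X i)] [∀ i, NormedSpace 𝕜 (X i)]

/-- The composition of the first `k` of the operators `T`, as a map from the first space. -/
def partialProduct (T : ∀ k : Fin n, X k.castSucc →L[𝕜] X k.succ) (k : Fin (n + 1)) :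
    X 0 →L[𝕜] X k :=
  Fin.induction (motive := fun k => X 0 →L[𝕜] X k) (ContinuousLinearMap.id 𝕜 (X 0))
    (fun k S => T k ∘L S) k

/-- The product of all the operators `T`, the one with the smallest index acting first. -/
def operatorProduct (T : ∀ k : Fin n, X k.castSucc →L[𝕜] X k.succ) :
    X 0 →L[𝕜] X (Fin.last n) :=
  partialProduct T (Fin.last n)

end Product

end

/-! Upper bound. Splitting each rank one term symmetrically, an `s`-nuclear operator factors through
`ℓ²` as `B D A` with `D` diagonal of Schatten exponent `1 / s - 1` (exponents are reciprocals `1 /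
p` here), while `A` and `B` have square summable coordinates (`IsSNuclear.exists_factorization`). In
a product of `n` such operators the `n - 1` inner maps `A B'` act on `ℓ²` and are Hilbert-Schmidt,
each adding exponent `1 / 2`. The total is `∑ (1 / s k - 1) + (n - 1) / 2 = ∑ 1 / s k - (n + 1) / 2
= 1 / r`.

Adding exponents with constant one is Hölder's inequality for Schatten classes. It is obtained from
`GramSchmidtBound`: the ratios of Gram-Schmidt lengths telescope under composition, so the weighted
AM-GM inequality suffices (`GramSchmidtBound.comp`). Testing on the singular vectors, which
Gram-Schmidt leaves unchanged, recovers the singular numbers (`GramSchmidtBound.memSchatten`).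

Sharpness. On `ℓ∞` over blocks of size `m = 2 ^ i`, every factor acts as a scaled Hadamard matrix,
so the product acts as a scalar `c` times a unitary matrix. If it factored through `S_p`, composing
with `ℓ²_m → ℓ∞_m` and `ℓ∞_m → ℓ²_m` would add two Hilbert-Schmidt maps, of norms at most `‖A‖` and
`√m ‖B‖`. Hence `m ^ (1 / p + 1) * c ≤ const * √m` (`card_mul_rpow_le_of_factorization`). As `c` is
`m ^ (n / 2 - ∑ 1 / s k)` up to a power of `i + 1`, this fails for large `i` when `1 / p > 1 / r`.
-/

noncomputable section

open InnerProductSpace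

/-! ### Gram-Schmidt lengths and a Hölder inequality for operators -/

section GramSchmidt

variable {𝕜 : Type*} [RCLike 𝕜] {E F G : Type*}
  [NormedAddCommGroup E] [InnerProductSpace 𝕜 E]
  [NormedAddCommGroup F] [InnerProductSpace 𝕜 F]
  [NormedAddCommGroup G] [InnerProductSpace 𝕜 G]

theorem norm_gramSchmidtNormed_le_one {N : ℕ} (v : Fin N → E) (j : Fin N) :
    ‖gramSchmidtNormed 𝕜 v j‖ ≤ 1 := by
  by_cases h : gramSchmidtNormed 𝕜 v j = 0
  · simp [h]
  · exact (gramSchmidtNormed_unit_length' h).le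

theorem norm_smul_gramSchmidtNormed {N : ℕ} (v : Fin N → E) (j : Fin N) :
    (‖gramSchmidt 𝕜 v j‖ : 𝕜) • gramSchmidtNormed 𝕜 v j = gramSchmidt 𝕜 v j := by
  by_cases h : gramSchmidt 𝕜 v j = 0
  · simp [h]
  · rw [gramSchmidtNormed, smul_smul, mul_inv_cancel₀ (by simpa using h), one_smul]

theorem gramSchmidt_fin_one (x : E) : gramSchmidt 𝕜 (fun _ : Fin 1 => x) 0 = x :=
  gramSchmidt_bot (𝕜 := 𝕜) (ι := Fin 1) fun _ => x

/-- Bessel's inequality for a Gram-Schmidt family. -/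
theorem sum_inner_gramSchmidtNormed_le {N : ℕ} (v : Fin N → E) (x : E) :
    ∑ j, ‖inner 𝕜 (gramSchmidtNormed 𝕜 v j) x‖ ^ 2 ≤ ‖x‖ ^ 2 := by
  classical
  have h := (gramSchmidtNormed_orthonormal' (𝕜 := 𝕜) v).sum_inner_products_le (x := x)
    (s := Finset.univ)
  refine le_trans (le_of_eq ?_) h
  rw [← Finset.sum_filter_of_ne (p := fun j => gramSchmidtNormed 𝕜 v j ≠ 0)]
  · exact Finset.sum_subtype _ (by simp) _
  · intro j _ h h0
    simp [h0] at h

theorem inner_gramSchmidt_eq_zero_of_lt {N : ℕ} (v : Fin N → E) (j : Fin N) (x : E)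
    (hx : x ∈ Submodule.span 𝕜 (v '' Set.Iio j)) : inner 𝕜 (gramSchmidt 𝕜 v j) x = 0 := by
  induction hx using Submodule.span_induction with
  | mem x hx =>
    obtain ⟨i, hi, rfl⟩ := hx
    exact gramSchmidt_inv_triangular 𝕜 v hi
  | zero => simp
  | add x y _ _ hx hy => simp [inner_add_right, hx, hy]
  | smul a x _ hx => simp [inner_smul_right, hx]

theorem sub_gramSchmidt_mem_span {N : ℕ} (v : Fin N → E) (j : Fin N) :
    v j - gramSchmidt 𝕜 v j ∈ Submodule.span 𝕜 (v '' Set.Iio j) := by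
  rw [gramSchmidt_def, sub_sub_cancel, ← span_gramSchmidt_Iio]
  refine Submodule.sum_mem _ fun i hi => ?_
  refine Submodule.span_mono ?_ (Submodule.starProjection_apply_mem _ _)
  rintro _ rfl
  exact ⟨i, by simpa using hi, rfl⟩

/-- The Gram-Schmidt residual `a*` of `A (v j)` is orthogonal to the images of the earlier vectors.
So `v j` may be replaced by its own residual `v*`, which gives `⟪a*, A v*⟫ = ‖a*‖ ^ 2`; normalizing
both residuals gives the estimate. -/
theorem norm_gramSchmidt_comp_le_inner (A : E →L[𝕜] F) {N : ℕ} (v : Fin N → E) (j : Fin N) :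
    ‖gramSchmidt 𝕜 (fun i => A (v i)) j‖ ≤
      ‖inner 𝕜 (gramSchmidtNormed 𝕜 (fun i => A (v i)) j) (A (gramSchmidtNormed 𝕜 v j))‖ *
        ‖gramSchmidt 𝕜 v j‖ := by
  set a := fun i => A (v i) with ha
  have h1 : inner 𝕜 (gramSchmidt 𝕜 a j) (A (gramSchmidt 𝕜 v j)) =
      (‖gramSchmidt 𝕜 a j‖ : 𝕜) ^ 2 := by
    have e1 : inner 𝕜 (gramSchmidt 𝕜 a j) (A (v j - gramSchmidt 𝕜 v j)) = 0 := by
      apply inner_gramSchmidt_eq_zero_of_lt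
      have := Submodule.mem_map_of_mem (f := (A : E →ₗ[𝕜] F)) (sub_gramSchmidt_mem_span (𝕜 := 𝕜) v j)
      rw [Submodule.map_span, ← Set.image_comp] at this
      exact this
    have e2 := inner_gramSchmidt_eq_zero_of_lt a j _ (sub_gramSchmidt_mem_span (𝕜 := 𝕜) a j)
    rw [map_sub, inner_sub_right, sub_eq_zero] at e1
    rw [inner_sub_right, sub_eq_zero, inner_self_eq_norm_sq_to_K] at e2
    rw [← e1, ← e2]
  by_cases h0 : gramSchmidt 𝕜 a j = 0
  · rw [h0, norm_zero]; positivity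
  have h2 : ‖gramSchmidt 𝕜 a j‖ * ‖gramSchmidt 𝕜 a j‖ = ‖gramSchmidt 𝕜 a j‖ *
      (‖inner 𝕜 (gramSchmidtNormed 𝕜 a j) (A (gramSchmidtNormed 𝕜 v j))‖ *
        ‖gramSchmidt 𝕜 v j‖) := by
    have := congrArg norm h1
    rw [← norm_smul_gramSchmidtNormed v, ← norm_smul_gramSchmidtNormed a, map_smul,
      inner_smul_left, inner_smul_right] at this
    simp only [norm_smul_gramSchmidtNormed, norm_mul, norm_pow, RCLike.norm_conj,
      RCLike.norm_ofReal, abs_norm] at this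
    nlinarith
  exact (mul_left_cancel₀ (by simpa using h0) h2).le

theorem norm_gramSchmidt_comp_le (A : E →L[𝕜] F) {N : ℕ} (v : Fin N → E) (j : Fin N) :
    ‖gramSchmidt 𝕜 (fun i => A (v i)) j‖ ≤
      ‖A (gramSchmidtNormed 𝕜 v j)‖ * ‖gramSchmidt 𝕜 v j‖ := by
  refine (norm_gramSchmidt_comp_le_inner A v j).trans
    (mul_le_mul_of_nonneg_right ?_ (norm_nonneg _))
  refine (norm_inner_le_norm _ _).trans ?_
  exact mul_le_of_le_one_left (norm_nonneg _) (norm_gramSchmidtNormed_le_one _ _)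

/-- The factors by which `A` changes the Gram-Schmidt lengths of any finite sequence of vectors are
bounded by `c * w j ^ t`, where the weights `w j` sum to at most one. For `t > 0` this bounds the
`1 / t`-Schatten quasinorm of `A` by `c`. -/
def GramSchmidtBound (t c : ℝ) (A : E →L[𝕜] F) : Prop :=
  ∀ (N : ℕ) (v : Fin N → E), ∃ w : Fin N → ℝ, (∀ j, 0 ≤ w j) ∧ ∑ j, w j ≤ 1 ∧
    ∀ j, ‖gramSchmidt 𝕜 (fun i => A (v i)) j‖ ≤ c * w j ^ t * ‖gramSchmidt 𝕜 v j‖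

namespace GramSchmidtBound

/-- Applying the bound for `B` to the sequence `A (v i)` makes the intermediate Gram-Schmidt lengths
cancel. The two weights are merged by their convex combination with coefficients proportional to
`t'` and `t`, so no constant is lost. -/
theorem comp {t t' c c' : ℝ} {A : E →L[𝕜] F} {B : F →L[𝕜] G} (ht : 0 ≤ t) (ht' : 0 ≤ t')
    (hc : 0 ≤ c) (hc' : 0 ≤ c')
    (hA : GramSchmidtBound t c A) (hB : GramSchmidtBound t' c' B) :
    GramSchmidtBound (t' + t) (c' * c) (B ∘L A) := by
  intro N v
  obtain ⟨w, hw0, hw1, hw⟩ := hA N v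
  obtain ⟨w', hw0', hw1', hw'⟩ := hB N (fun i => A (v i))
  -- The coefficients `t' / (t' + t)` make no sense when both exponents vanish; then the weights
  -- play no role.
  rcases (add_nonneg ht' ht).eq_or_lt with h | h
  · have h1 : t = 0 := by linarith
    have h2 : t' = 0 := by linarith
    subst h1 h2
    refine ⟨w, hw0, hw1, fun j => (hw' j).trans ?_⟩
    have := hw j
    simp only [Real.rpow_zero, mul_one, add_zero] at this ⊢
    rw [mul_assoc]
    exact mul_le_mul_of_nonneg_left this hc'
  · refine ⟨fun j => t' / (t' + t) * w' j + t / (t' + t) * w j, fun j => ?_, ?_, fun j => ?_⟩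
    · have := hw0 j; have := hw0' j; positivity
    · rw [Finset.sum_add_distrib, ← Finset.mul_sum, ← Finset.mul_sum]
      have e : t' / (t' + t) + t / (t' + t) = 1 := by field_simp
      have : 0 ≤ t' / (t' + t) := by positivity
      have : 0 ≤ t / (t' + t) := by positivity
      nlinarith
    · have key : w' j ^ t' * w j ^ t ≤
          (t' / (t' + t) * w' j + t / (t' + t) * w j) ^ (t' + t) := by
        have := Real.geom_mean_le_arith_mean2_weighted (w₁ := t' / (t' + t)) (w₂ := t / (t' + t))
          (by positivity) (by positivity) (hw0' j) (hw0 j) (by field_simp)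
        have := Real.rpow_le_rpow (mul_nonneg (Real.rpow_nonneg (hw0' j) _)
          (Real.rpow_nonneg (hw0 j) _)) this h.le
        rwa [Real.mul_rpow (Real.rpow_nonneg (hw0' j) _) (Real.rpow_nonneg (hw0 j) _),
          ← Real.rpow_mul (hw0' j), ← Real.rpow_mul (hw0 j), div_mul_cancel₀ _ h.ne',
          div_mul_cancel₀ _ h.ne'] at this
      have hw'j : 0 ≤ w' j ^ t' := Real.rpow_nonneg (hw0' j) _
      calc ‖gramSchmidt 𝕜 (fun i => (B ∘L A) (v i)) j‖
          ≤ c' * w' j ^ t' * ‖gramSchmidt 𝕜 (fun i => A (v i)) j‖ := hw' j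
        _ ≤ c' * w' j ^ t' * (c * w j ^ t * ‖gramSchmidt 𝕜 v j‖) := by gcongr; exact hw j
        _ = c' * c * (w' j ^ t' * w j ^ t) * ‖gramSchmidt 𝕜 v j‖ := by ring
        _ ≤ _ := by gcongr

theorem of_norm_le {c : ℝ} {A : E →L[𝕜] F} (h : ‖A‖ ≤ c) : GramSchmidtBound 0 c A := by
  intro N v
  refine ⟨fun _ => 0, fun _ => le_rfl, by simp, fun j => ?_⟩
  refine (norm_gramSchmidt_comp_le A v j).trans (mul_le_mul_of_nonneg_right ?_ (norm_nonneg _))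
  rw [Real.rpow_zero, mul_one]
  refine (A.le_opNorm _).trans ((mul_le_of_le_one_right (norm_nonneg _)
    (norm_gramSchmidtNormed_le_one _ _)).trans h)

theorem norm_le {c : ℝ} {A : E →L[𝕜] F} (h : GramSchmidtBound 0 c A) (hc : 0 ≤ c) : ‖A‖ ≤ c := by
  refine A.opNorm_le_bound hc fun x => ?_
  obtain ⟨w, -, -, hw⟩ := h 1 (fun _ => x)
  simpa only [gramSchmidt_fin_one, Real.rpow_zero, mul_one] using hw 0

/-- A bound on the Hilbert-Schmidt sums over Gram-Schmidt families. -/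
theorem of_sum_sq_le {c : ℝ} (hc : 0 ≤ c) {A : E →L[𝕜] F}
    (h : ∀ (N : ℕ) (v : Fin N → E) (u : Fin N → F),
      ∑ j, ‖inner 𝕜 (gramSchmidtNormed 𝕜 u j) (A (gramSchmidtNormed 𝕜 v j))‖ ^ 2 ≤ c ^ 2) :
    GramSchmidtBound (1 / 2) c A := by
  intro N v
  set ρ := fun j => ‖inner 𝕜 (gramSchmidtNormed 𝕜 (fun i => A (v i)) j)
    (A (gramSchmidtNormed 𝕜 v j))‖ with hρ
  have hs : ∑ j, ρ j ^ 2 ≤ c ^ 2 := h N v _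
  rcases hc.eq_or_lt with rfl | hc
  · refine ⟨fun _ => 0, fun _ => le_rfl, by simp, fun j => ?_⟩
    have h0 : ρ j ^ 2 ≤ 0 := by
      refine (Finset.single_le_sum (f := fun j => ρ j ^ 2) (fun i _ => sq_nonneg _)
        (Finset.mem_univ j)).trans (hs.trans (by simp))
    have h0 : ρ j = 0 := by nlinarith
    have := norm_gramSchmidt_comp_le_inner A v j
    simp only [hρ] at h0
    rw [h0] at this
    simpa using this
  · refine ⟨fun j => ρ j ^ 2 / c ^ 2, fun j => by positivity, ?_, fun j => ?_⟩
    · rw [← Finset.sum_div]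
      exact div_le_one_of_le₀ hs (by positivity)
    · refine (norm_gramSchmidt_comp_le_inner A v j).trans (le_of_eq ?_)
      have : 0 ≤ ρ j := norm_nonneg _
      beta_reduce
      change ρ j * _ = _
      rw [← Real.sqrt_eq_rpow, ← div_pow, Real.sqrt_sq (by positivity)]
      field_simp

variable {ι : Type*}

/-- Parseval in the basis `b`, an exchange of the two sums, and Bessel's inequality for the
Gram-Schmidt family applied to each `A.adjoint (b i)`. -/
theorem sum_apply_gramSchmidtNormed_le [CompleteSpace E] [CompleteSpace F] {A : E →L[𝕜] F}
    (b : HilbertBasis ι 𝕜 F) {c : ℝ} (hb : Summable fun i => ‖A.adjoint (b i)‖ ^ 2)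
    (hc : ∑' i, ‖A.adjoint (b i)‖ ^ 2 ≤ c ^ 2) (N : ℕ) (v : Fin N → E) :
    ∑ j, ‖A (gramSchmidtNormed 𝕜 v j)‖ ^ 2 ≤ c ^ 2 := by
  have h1 : ∀ x : F, HasSum (fun i => ‖inner 𝕜 (b i) x‖ ^ 2) (‖x‖ ^ 2) := fun x => by
    have := b.hasSum_inner_mul_inner x x
    rw [inner_self_eq_norm_sq_to_K] at this
    rw [← RCLike.hasSum_ofReal (𝕜 := 𝕜)]
    convert this using 1
    · ext i
      rw [← inner_conj_symm x (b i), RCLike.conj_mul]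
      push_cast; rfl
    · push_cast; rfl
  have h2 := hasSum_sum (s := Finset.univ) fun j (_ : j ∈ Finset.univ) =>
    h1 (A (gramSchmidtNormed 𝕜 v j))
  rw [← h2.tsum_eq]
  refine (Summable.tsum_le_tsum (fun i => ?_) h2.summable hb).trans hc
  refine le_trans (le_of_eq ?_) (sum_inner_gramSchmidtNormed_le (𝕜 := 𝕜) v (A.adjoint (b i)))
  refine Finset.sum_congr rfl fun j _ => ?_
  rw [← ContinuousLinearMap.adjoint_inner_left, ← inner_conj_symm, RCLike.norm_conj]

theorem of_adjoint_basis [CompleteSpace E] [CompleteSpace F] {A : E →L[𝕜] F}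
    (b : HilbertBasis ι 𝕜 F) {c : ℝ} (hc0 : 0 ≤ c) (hb : Summable fun i => ‖A.adjoint (b i)‖ ^ 2)
    (hc : ∑' i, ‖A.adjoint (b i)‖ ^ 2 ≤ c ^ 2) : GramSchmidtBound (1 / 2) c A := by
  refine of_sum_sq_le hc0 fun N v u => ?_
  refine le_trans (Finset.sum_le_sum fun j _ => ?_) (sum_apply_gramSchmidtNormed_le b hb hc N v)
  gcongr
  refine (norm_inner_le_norm _ _).trans ?_
  exact mul_le_of_le_one_left (norm_nonneg _) (norm_gramSchmidtNormed_le_one _ _)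

theorem of_basis [CompleteSpace E] [CompleteSpace F] {A : E →L[𝕜] F}
    (b : HilbertBasis ι 𝕜 E) {c : ℝ} (hc0 : 0 ≤ c) (hb : Summable fun i => ‖A (b i)‖ ^ 2)
    (hc : ∑' i, ‖A (b i)‖ ^ 2 ≤ c ^ 2) : GramSchmidtBound (1 / 2) c A := by
  refine of_sum_sq_le hc0 fun N v u => ?_
  refine le_trans (Finset.sum_le_sum fun j _ => ?_) (sum_apply_gramSchmidtNormed_le
    (A := A.adjoint) b (by simpa using hb) (by simpa using hc) N u)
  gcongr
  rw [← ContinuousLinearMap.adjoint_inner_left]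
  refine (norm_inner_le_norm _ _).trans ?_
  exact mul_le_of_le_one_right (norm_nonneg _) (norm_gramSchmidtNormed_le_one _ _)

end GramSchmidtBound

end GramSchmidt

/-! ### Diagonal operators on `ℓ²` -/

section Diagonal

variable {𝕜 : Type*} [RCLike 𝕜] {ι : Type*}

/-- The diagonal operator on `ℓ²` with a sequence bounded by one. -/
def lpDiagonal (d : ι → ℝ) (hd : ∀ i, |d i| ≤ 1) :
    lp (fun _ : ι => 𝕜) 2 →L[𝕜] lp (fun _ : ι => 𝕜) 2 :=
  LinearMap.mkContinuous
    { toFun := fun f => ⟨fun i => (d i : 𝕜) * f i, (lp.memℓp f).mono' fun i => by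
        simpa using mul_le_of_le_one_left (norm_nonneg (f i)) (hd i)⟩
      map_add' := fun f g => by
        ext i
        exact mul_add _ _ _
      map_smul' := fun a f => by
        ext i
        simp [mul_left_comm] } 1 fun f => by
    rw [one_mul]
    exact lp.norm_mono two_ne_zero fun i => by
      simpa using mul_le_of_le_one_left (norm_nonneg (f i)) (hd i)

theorem lpDiagonal_apply (d : ι → ℝ) (hd : ∀ i, |d i| ≤ 1) (f : lp (fun _ : ι => 𝕜) 2) (i : ι) :
    lpDiagonal d hd f i = (d i : 𝕜) * f i := rfl

theorem norm_lpDiagonal_le (d : ι → ℝ) (hd : ∀ i, |d i| ≤ 1) {c : ℝ} (hc : 0 ≤ c)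
    (hdc : ∀ i, |d i| ≤ c) :
    ‖(lpDiagonal d hd : lp (fun _ : ι => 𝕜) 2 →L[𝕜] _)‖ ≤ c := by
  refine ContinuousLinearMap.opNorm_le_bound _ hc fun f => ?_
  have h : ‖lpDiagonal d hd f‖ ≤ ‖(c : 𝕜) • f‖ := lp.norm_mono two_ne_zero fun i => by
    rw [lpDiagonal_apply, lp.coeFn_smul, Pi.smul_apply, norm_smul, norm_mul, RCLike.norm_ofReal,
      RCLike.norm_ofReal, abs_of_nonneg hc]
    exact mul_le_mul_of_nonneg_right (hdc i) (norm_nonneg _)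
  rwa [norm_smul, RCLike.norm_ofReal, abs_of_nonneg hc] at h

theorem hasSum_norm_sq (f : lp (fun _ : ι => 𝕜) 2) : HasSum (fun i => ‖f i‖ ^ 2) (‖f‖ ^ 2) := by
  simpa using lp.hasSum_norm (p := 2) (by simp) f

theorem inner_single_one [DecidableEq ι] (f : lp (fun _ : ι => 𝕜) 2) (i : ι) :
    inner 𝕜 (lp.single 2 i (1 : 𝕜)) f = f i := by
  rw [lp.inner_single_left]; simp

theorem summable_mul_rpow_of_le {δ u : ι → ℝ} {t : ℝ} (ht : 0 ≤ t) (hδ : ∀ i, 0 ≤ δ i)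
    (hδ1 : ∀ i, δ i ≤ 1) (hu : ∀ i, 0 ≤ u i) (hus : Summable u) :
    Summable fun i => δ i ^ t * u i :=
  hus.of_nonneg_of_le (fun i => mul_nonneg (Real.rpow_nonneg (hδ i) _) (hu i)) fun i =>
    mul_le_of_le_one_left (hu i) (Real.rpow_le_one (hδ i) (hδ1 i) ht)

/-- Jensen's inequality for the concave power functions. -/
theorem tsum_rpow_mul_le {δ u : ι → ℝ} {t : ℝ} (ht : 0 < t) (ht1 : t ≤ 1) (hδ : ∀ i, 0 ≤ δ i)
    (hδ1 : ∀ i, δ i ≤ 1) (hu : ∀ i, 0 ≤ u i) (hus : Summable u) (hu1 : ∑' i, u i ≤ 1) :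
    ∑' i, δ i ^ t * u i ≤ (∑' i, δ i * u i) ^ t := by
  have hs : Summable fun i => δ i * u i := by
    simpa using summable_mul_rpow_of_le zero_le_one hδ hδ1 hu hus
  have hst := summable_mul_rpow_of_le ht.le hδ hδ1 hu hus
  set w := ∑' i, δ i * u i with hw
  have hw0 : 0 ≤ w := tsum_nonneg fun i => mul_nonneg (hδ i) (hu i)
  rcases hw0.eq_or_lt with h | h
  · have h0 : ∀ i, δ i * u i = 0 := by
      have := (hasSum_zero_iff_of_nonneg fun i => mul_nonneg (hδ i) (hu i)).1
        (by rw [h]; exact hs.hasSum)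
      exact fun i => congrFun this i
    have h1 : ∀ i, δ i ^ t * u i = 0 := fun i => by
      rcases mul_eq_zero.1 (h0 i) with h | h
      · simp [h, ht.ne']
      · simp [h]
    simp only [h1, tsum_zero]
    exact Real.rpow_nonneg hw0 _
  · have hp : 0 < w ^ (1 - t) := Real.rpow_pos_of_pos h _
    have e : w ^ t * w ^ (1 - t) = w := by
      rw [← Real.rpow_add h]; simp
    have key : ∀ i, δ i ^ t * u i * w ^ (1 - t) ≤ t * (δ i * u i) + (1 - t) * w * u i := fun i => by
      have := Real.geom_mean_le_arith_mean2_weighted ht.le (sub_nonneg.2 ht1) (hδ i) hw0 (by ring)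
      have := mul_le_mul_of_nonneg_right this (hu i)
      linarith
    have h2 : (∑' i, δ i ^ t * u i) * w ^ (1 - t) ≤ t * w + (1 - t) * w * ∑' i, u i := by
      rw [← tsum_mul_right, hw, ← tsum_mul_left, ← tsum_mul_left, ← (hs.mul_left t).tsum_add
        (hus.mul_left _)]
      exact (hst.mul_right _).tsum_le_tsum key ((hs.mul_left t).add (hus.mul_left _))
    have h3 : (1 - t) * w * ∑' i, u i ≤ (1 - t) * w :=
      mul_le_of_le_one_right (mul_nonneg (sub_nonneg.2 ht1) hw0) hu1
    rw [← mul_le_mul_iff_left₀ hp, e]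
    linarith

theorem abs_rpow_le_one {δ : ι → ℝ} {t : ℝ} (ht : 0 ≤ t) (hδ : ∀ i, 0 ≤ δ i)
    (hδ1 : ∀ i, δ i ≤ 1) (i : ι) : |δ i ^ t| ≤ 1 := by
  rw [abs_of_nonneg (Real.rpow_nonneg (hδ i) _)]
  exact Real.rpow_le_one (hδ i) (hδ1 i) ht

/-- The weights are `w j = ∑ δ i |g j i| ^ 2` for the Gram-Schmidt family `g`. Bessel's inequality
at the unit vectors bounds their sum by `∑ δ i`, and Jensen's inequality bounds `‖D (g j)‖ ^ 2` by
`w j ^ (2 t)`. Concavity needs `2 t ≤ 1`. -/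
theorem gramSchmidtBound_lpDiagonal_of_le {δ : ι → ℝ} {t : ℝ} (ht : 0 ≤ t) (ht1 : t ≤ 1 / 2)
    (hδ : ∀ i, 0 ≤ δ i) (hδ1 : ∀ i, δ i ≤ 1) (hδs : Summable δ) (hδt : ∑' i, δ i ≤ 1) :
    GramSchmidtBound t 1 (lpDiagonal (𝕜 := 𝕜) (fun i => δ i ^ t) (abs_rpow_le_one ht hδ hδ1)) := by
  classical
  rcases ht.eq_or_lt with rfl | ht
  · exact .of_norm_le (norm_lpDiagonal_le _ _ zero_le_one (abs_rpow_le_one le_rfl hδ hδ1))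
  intro N v
  set g := gramSchmidtNormed 𝕜 v
  have hus : ∀ j, Summable fun i => ‖g j i‖ ^ 2 := fun j => (hasSum_norm_sq (g j)).summable
  have hs : ∀ j, Summable fun i => δ i * ‖g j i‖ ^ 2 := fun j => by
    simpa using summable_mul_rpow_of_le zero_le_one hδ hδ1 (fun i => sq_nonneg _) (hus j)
  refine ⟨fun j => ∑' i, δ i * ‖g j i‖ ^ 2, fun j => tsum_nonneg fun i =>
    mul_nonneg (hδ i) (sq_nonneg _), ?_, fun j => ?_⟩
  · rw [← Summable.tsum_finsetSum fun j _ => hs j]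
    refine (Summable.tsum_le_tsum (fun i => ?_) (summable_sum fun j _ => hs j) hδs).trans hδt
    rw [← Finset.mul_sum]
    refine mul_le_of_le_one_right (hδ i) ?_
    set e : lp (fun _ : ι => 𝕜) 2 := lp.single 2 i (1 : 𝕜) with he
    have h := sum_inner_gramSchmidtNormed_le (𝕜 := 𝕜) v e
    have h1 : ‖e‖ = 1 := by rw [he, lp.norm_single (by simp), norm_one]
    rw [h1, one_pow] at h
    refine le_trans (le_of_eq (Finset.sum_congr rfl fun j _ => ?_)) h
    rw [← inner_conj_symm, RCLike.norm_conj, he, inner_single_one]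
  · refine (norm_gramSchmidt_comp_le _ v j).trans
      (mul_le_mul_of_nonneg_right ?_ (norm_nonneg _))
    rw [one_mul]
    have hw0 : 0 ≤ ∑' i, δ i * ‖g j i‖ ^ 2 :=
      tsum_nonneg fun i => mul_nonneg (hδ i) (sq_nonneg _)
    refine abs_le_of_sq_le_sq' ?_ (Real.rpow_nonneg hw0 _) |>.2
    rw [← (hasSum_norm_sq _).tsum_eq, ← Real.rpow_natCast, ← Real.rpow_mul hw0, mul_comm t]
    refine le_trans (le_of_eq ?_) (tsum_rpow_mul_le (by positivity) (by push_cast; linarith)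
      hδ hδ1 (fun i => sq_nonneg ‖g j i‖) (hus j) ?_)
    · refine tsum_congr fun i => ?_
      rw [lpDiagonal_apply, norm_mul, mul_pow, RCLike.norm_ofReal, sq_abs, mul_comm _ t,
        Real.rpow_mul (hδ i), Real.rpow_natCast]
    · rw [(hasSum_norm_sq (g j)).tsum_eq]
      exact pow_le_one₀ (norm_nonneg _) (norm_gramSchmidtNormed_le_one v j)

/-- For large `t`, factors of exponent `1 / 2` are split off one at a time and recombined with
`GramSchmidtBound.comp`. -/
theorem gramSchmidtBound_lpDiagonal {δ : ι → ℝ} {t : ℝ} (ht : 0 ≤ t)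
    (hδ : ∀ i, 0 ≤ δ i) (hδ1 : ∀ i, δ i ≤ 1) (hδs : Summable δ) (hδt : ∑' i, δ i ≤ 1) :
    GramSchmidtBound t 1 (lpDiagonal (𝕜 := 𝕜) (fun i => δ i ^ t) (abs_rpow_le_one ht hδ hδ1)) := by
  suffices h : ∀ (m : ℕ) (t : ℝ) (ht : 0 ≤ t), t ≤ (m + 1) / 2 → GramSchmidtBound t 1
      (lpDiagonal (𝕜 := 𝕜) (fun i => δ i ^ t) (abs_rpow_le_one ht hδ hδ1)) by
    obtain ⟨m, hm⟩ := exists_nat_ge (2 * t)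
    exact h m t ht (by linarith)
  intro m
  induction m with
  | zero =>
    intro t ht h
    exact gramSchmidtBound_lpDiagonal_of_le ht (by simpa using h) hδ hδ1 hδs hδt
  | succ m ih =>
    intro t ht h
    by_cases ht1 : t ≤ 1 / 2
    · exact gramSchmidtBound_lpDiagonal_of_le ht ht1 hδ hδ1 hδs hδt
    push Not at ht1
    have ht2 : 0 ≤ t - 1 / 2 := by linarith
    have h1 := gramSchmidtBound_lpDiagonal_of_le (𝕜 := 𝕜) (t := 1 / 2) (by norm_num) le_rfl
      hδ hδ1 hδs hδt
    have h2 := ih (t - 1 / 2) ht2 (by push_cast at h; linarith)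
    have h3 := h1.comp (by norm_num) ht2 zero_le_one zero_le_one h2
    rw [sub_add_cancel, one_mul] at h3
    convert h3 using 1
    ext f i
    rw [ContinuousLinearMap.comp_apply, lpDiagonal_apply, lpDiagonal_apply, lpDiagonal_apply,
      ← mul_assoc, ← RCLike.ofReal_mul, ← Real.rpow_add' (hδ i) (by linarith), sub_add_cancel]

theorem isCompactOperator_lpDiagonal (d : ℕ → ℝ) (hd : ∀ i, |d i| ≤ 1)
    (h0 : Filter.Tendsto d Filter.atTop (nhds 0)) :
    IsCompactOperator (lpDiagonal (𝕜 := 𝕜) d hd) := by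
  have hd' : ∀ N i, |if i < N then d i else 0| ≤ 1 := fun N i => by
    split_ifs
    · exact hd i
    · simp
  refine isCompactOperator_of_tendsto (l := Filter.atTop)
    (F := fun N : ℕ => lpDiagonal (𝕜 := 𝕜) (fun i => if i < N then d i else 0) (hd' N)) ?_
    (.of_forall fun N => ?_)
  · rw [tendsto_iff_norm_sub_tendsto_zero, Metric.tendsto_atTop]
    intro ε hε
    obtain ⟨M, hM⟩ := Metric.tendsto_atTop.1 h0 (ε / 2) (by positivity)
    refine ⟨M, fun N hN => ?_⟩
    have hb : ∀ i, |if i < N then 0 else -d i| ≤ ε / 2 := fun i => by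
      split_ifs with h
      · simp; positivity
      · have := hM i (by omega)
        rw [Real.dist_0_eq_abs] at this
        rw [abs_neg]; exact this.le
    have hb1 : ∀ i, |if i < N then 0 else -d i| ≤ 1 := fun i => by
      split_ifs with h
      · simp
      · rw [abs_neg]; exact hd i
    have e : lpDiagonal (𝕜 := 𝕜) (fun i => if i < N then d i else 0) (hd' N) - lpDiagonal d hd =
        lpDiagonal (fun i => if i < N then 0 else -d i) hb1 := by
      ext f i
      rw [sub_apply, lp.coeFn_sub, Pi.sub_apply, lpDiagonal_apply,
        lpDiagonal_apply, lpDiagonal_apply]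
      split_ifs <;> simp
    rw [e, Real.dist_0_eq_abs, abs_norm]
    exact (norm_lpDiagonal_le _ _ (by positivity) hb).trans_lt (by linarith)
  · have e : lpDiagonal (𝕜 := 𝕜) (fun i => if i < N then d i else 0) (hd' N) =
        ∑ i ∈ Finset.range N, (lp.singleContinuousLinearMap 𝕜 (fun _ : ℕ => 𝕜) 2 i) ∘L
          ((d i : 𝕜) • lp.evalCLM 𝕜 (fun _ : ℕ => 𝕜) 2 i) := by
      ext f i
      rw [sum_apply, lp.coeFn_sum, Finset.sum_apply, lpDiagonal_apply]
      simp only [ContinuousLinearMap.comp_apply, lp.singleContinuousLinearMap_apply,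
        lp.single_apply, Pi.single_apply, Finset.sum_ite_eq, Finset.mem_range]
      split_ifs
      · rfl
      · simp
    rw [e]
    refine Submodule.sum_mem (compactOperator (RingHom.id 𝕜) (lp (fun _ : ℕ => 𝕜) 2)
      (lp (fun _ : ℕ => 𝕜) 2)) fun i _ => ?_
    exact ((isCompactOperator_id (E := 𝕜)).comp_clm
      ((d i : 𝕜) • lp.evalCLM 𝕜 (fun _ : ℕ => 𝕜) 2 i)).clm_comp
      (lp.singleContinuousLinearMap 𝕜 (fun _ : ℕ => 𝕜) 2 i)

end Diagonal

/-! ### Schmidt decompositions and singular sequences -/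

section Schmidt

variable {𝕜 : Type*} [RCLike 𝕜] {H : Type*} [NormedAddCommGroup H] [InnerProductSpace 𝕜 H]

/-- Hilbert bases of pairwise orthogonal closed subspaces form a Hilbert basis of the whole space if
only zero is orthogonal to all of the subspaces. -/
theorem exists_hilbertBasis_mem_of_orthogonalFamily [CompleteSpace H] {α : Type*}
    (V : α → Submodule 𝕜 H) [∀ a, CompleteSpace (V a)]
    (hV : OrthogonalFamily 𝕜 (fun a => V a) fun a => (V a).subtypeₗᵢ) (hbot : (⨆ a, V a)ᗮ = ⊥) :
    ∃ (w : Set H) (b : HilbertBasis w 𝕜 H), ∀ i, ∃ a, b i ∈ V a := by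
  choose w b hb using fun a => exists_hilbertBasis 𝕜 (V a)
  have ho : Orthonormal 𝕜 fun a : Σ a, w a => ((b a.1 a.2 : _) : H) :=
    hV.orthonormal_sigma_orthonormal fun a => (b a).orthonormal
  have hbot : (Submodule.span 𝕜 (Set.range fun a : Σ a, w a => ((b a.1 a.2 : _) : H)))ᗮ = ⊥ := by
    rw [eq_bot_iff, ← hbot, ← Submodule.iInf_orthogonal]
    intro x hx
    rw [Submodule.mem_iInf]
    intro a y hy
    have h1 := ((b a).hasSum_repr ⟨y, hy⟩).mapL ((innerSL 𝕜 x) ∘L (V a).subtypeL)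
    have h2 : ∀ i : w a, inner 𝕜 x ((b a i : _) : H) = 0 := fun i => by
      rw [← inner_conj_symm, hx _ (Submodule.subset_span ⟨⟨a, i⟩, rfl⟩), map_zero]
    have h3 := h1.unique (a₂ := 0) (by
      convert hasSum_zero with i
      simp [h2])
    rw [inner_eq_zero_symm]
    simpa using h3
  refine ⟨_, HilbertBasis.mkOfOrthogonalEqBot ho.toSubtypeRange (by rwa [Subtype.range_coe]), ?_⟩
  rintro ⟨_, a, rfl⟩
  rw [HilbertBasis.coe_mkOfOrthogonalEqBot]
  exact ⟨a.1, (b a.1 a.2).2⟩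

/-- An eigenbasis of a compact symmetric operator. -/
theorem exists_hilbertBasis_eigenvectors [CompleteSpace H] {S : H →L[𝕜] H}
    (hS : IsCompactOperator S) (hS' : S.IsSymmetric) :
    ∃ (w : Set H) (b : HilbertBasis w 𝕜 H), ∀ i, ∃ ν : 𝕜, S (b i) = ν • b i := by
  have hclosed : ∀ ν : 𝕜, IsClosed (Module.End.eigenspace (S : Module.End 𝕜 H) ν : Set H) :=
    fun ν => by
      have : (Module.End.eigenspace (S : Module.End 𝕜 H) ν : Set H) = {x | S x = ν • x} := by
        ext x
        simp
      rw [this]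
      exact isClosed_eq S.continuous (continuous_const_smul ν)
  have (ν : 𝕜) : CompleteSpace (Module.End.eigenspace (S : Module.End 𝕜 H) ν) :=
    (hclosed ν).completeSpace_coe
  obtain ⟨w, b, hb⟩ := exists_hilbertBasis_mem_of_orthogonalFamily _
    hS'.orthogonalFamily_eigenspaces
    (ContinuousLinearMap.orthogonalComplement_iSup_eigenspaces_eq_bot hS hS')
  exact ⟨w, b, fun i => (hb i).imp fun ν h => Module.End.mem_eigenspace_iff.1 h⟩

/-- The Schmidt decomposition of a compact operator. -/
theorem exists_schmidt_decomposition [CompleteSpace H] {U : H →L[𝕜] H}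
    (hU : IsCompactOperator U) :
    ∃ (w : Set H) (ι : Set w) (μ : ι → ℝ) (e f : ι → H), (∀ i, 0 < μ i) ∧ Orthonormal 𝕜 e ∧
      Orthonormal 𝕜 f ∧ ∀ x, HasSum (fun i => ((μ i : 𝕜) * inner 𝕜 (e i) x) • f i) (U x) := by
  have hS : IsCompactOperator (U.adjoint ∘L U) := hU.clm_comp U.adjoint
  have hS' : (U.adjoint ∘L U).IsSymmetric := fun x y => by
    change inner 𝕜 (U.adjoint (U x)) y = inner 𝕜 x (U.adjoint (U y))
    rw [ContinuousLinearMap.adjoint_inner_left, ContinuousLinearMap.adjoint_inner_right]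
  obtain ⟨w, b, hb⟩ := exists_hilbertBasis_eigenvectors hS hS'
  -- The images of an eigenbasis of `U.adjoint ∘L U` are pairwise orthogonal; the nonzero ones,
  -- normalized, are the left singular vectors.
  have horth : ∀ i j, i ≠ j → inner 𝕜 (U (b i)) (U (b j)) = 0 := fun i j hij => by
    obtain ⟨ν, hν⟩ := hb j
    have h := congrArg (inner 𝕜 (b i)) hν
    rw [ContinuousLinearMap.comp_apply, ContinuousLinearMap.adjoint_inner_right,
      inner_smul_right, b.orthonormal.2 hij, mul_zero] at h
    exact h
  have key : ∀ x, HasSum (fun i => ((‖U (b i)‖ : 𝕜) * inner 𝕜 (b i) x) •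
      ((‖U (b i)‖ : 𝕜)⁻¹ • U (b i))) (U x) := fun x => by
    convert (b.hasSum_repr x).mapL U using 1
    ext i
    by_cases h0 : U (b i) = 0
    · simp [h0]
    have : (‖U (b i)‖ : 𝕜) ≠ 0 := by simpa using h0
    rw [map_smul, b.repr_apply_apply, smul_smul]
    congr 1
    field_simp
  refine ⟨w, {i : w | 0 < ‖U (b i)‖}, fun i => ‖U (b i)‖, fun i => b i,
    fun i => (‖U (b i)‖ : 𝕜)⁻¹ • U (b i), fun i => i.2, b.orthonormal.comp _
    Subtype.val_injective, ⟨fun i => ?_, fun i j hij => ?_⟩, fun x =>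
    (hasSum_subtype_iff_of_support_subset fun i hi => ?_).2 (key x)⟩
  · rw [norm_smul, norm_inv, RCLike.norm_ofReal, abs_norm, inv_mul_cancel₀ i.2.ne']
  · beta_reduce
    rw [inner_smul_left, inner_smul_right, horth _ _ (fun h => hij (Subtype.ext h)), mul_zero,
      mul_zero]
  · rw [Set.mem_ofPred_eq, norm_pos_iff]
    rintro h0
    simp [h0] at hi

theorem apply_of_hasSum_schmidt {ι : Type*} {U : H →L[𝕜] H} {μ : ι → ℝ} {e f : ι → H}
    (he : Orthonormal 𝕜 e)
    (hU : ∀ x, HasSum (fun i => ((μ i : 𝕜) * inner 𝕜 (e i) x) • f i) (U x)) (i : ι) :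
    U (e i) = (μ i : 𝕜) • f i := by
  classical
  refine (hU (e i)).unique ?_
  convert hasSum_ite_eq i ((μ i : 𝕜) • f i) using 2 with j
  rw [orthonormal_iff_ite.1 he]
  split_ifs with h
  · rw [h, mul_one]
  · rw [mul_zero, zero_smul]

/-- Both `e` and its image under `U` are orthogonal systems, so Gram-Schmidt fixes them and the
length ratios are the singular numbers themselves. -/
theorem GramSchmidtBound.sum_rpow_le {ι : Type*} {U : H →L[𝕜] H} {t c : ℝ} (ht : 0 < t)
    (hc : 0 ≤ c) (h : GramSchmidtBound t c U) {μ : ι → ℝ} {e f : ι → H} (hμ : ∀ i, 0 ≤ μ i)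
    (he : Orthonormal 𝕜 e) (hf : Orthonormal 𝕜 f) (hU : ∀ i, U (e i) = (μ i : 𝕜) • f i)
    (s : Finset ι) : ∑ i ∈ s, μ i ^ (1 / t) ≤ c ^ (1 / t) := by
  classical
  set g : Fin s.card → ι := fun j => (s.equivFin.symm j : ι) with hg
  have hgi : Function.Injective g := Subtype.val_injective.comp s.equivFin.symm.injective
  obtain ⟨w, hw0, hw1, hw⟩ := h s.card (fun j => e (g j))
  have h1 : gramSchmidt 𝕜 (fun j => e (g j)) = fun j => e (g j) :=
    gramSchmidt_of_orthogonal 𝕜 fun i j hij => he.2 (hgi.ne hij)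
  have h2 : gramSchmidt 𝕜 (fun j => U (e (g j))) = fun j => U (e (g j)) :=
    gramSchmidt_of_orthogonal 𝕜 fun i j hij => by
      simp [hU, inner_smul_left, inner_smul_right, hf.2 (hgi.ne hij)]
  have h3 : ∀ j, μ (g j) ≤ c * w j ^ t := fun j => by
    have := hw j
    rw [h1, h2] at this
    beta_reduce at this
    rw [hU, norm_smul, hf.1, he.1, RCLike.norm_ofReal, abs_of_nonneg (hμ _)] at this
    simpa using this
  calc ∑ i ∈ s, μ i ^ (1 / t) = ∑ j, μ (g j) ^ (1 / t) := by
        rw [← Finset.sum_coe_sort, ← s.equivFin.symm.sum_comp]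
    _ ≤ ∑ j, c ^ (1 / t) * w j := Finset.sum_le_sum fun j _ => by
        have := Real.rpow_le_rpow (hμ _) (h3 j) (z := 1 / t) (by positivity)
        rwa [Real.mul_rpow hc (Real.rpow_nonneg (hw0 j) _), ← Real.rpow_mul (hw0 j),
          mul_one_div_cancel ht.ne', Real.rpow_one] at this
    _ ≤ c ^ (1 / t) := by
        rw [← Finset.mul_sum]
        exact mul_le_of_le_one_right (Real.rpow_nonneg hc _) hw1

/-- Passes from an arbitrary injectively numbered index set to `ℕ`, padding with zeros. -/
theorem isSingularSeq_extend {ι : Type*} {enc : ι → ℕ} (henc : Function.Injective enc)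
    {U : H →L[𝕜] H} {μ : ι → ℝ} {e f : ι → H} (hμ : ∀ i, 0 < μ i) (he : Orthonormal 𝕜 e)
    (hf : Orthonormal 𝕜 f)
    (hU : ∀ x, HasSum (fun i => ((μ i : 𝕜) * inner 𝕜 (e i) x) • f i) (U x)) :
    IsSingularSeq U (Function.extend enc μ 0) := by
  have hpre : ∀ n : {n // 0 < Function.extend enc μ 0 n}, ∃ i, enc i = n := fun n => by
    by_contra h
    have := n.2
    rw [Function.extend_apply' _ _ _ h] at this
    simp at this
  choose g hg using hpre
  have hgi : Function.Injective g := fun m n h => Subtype.ext (by rw [← hg m, ← hg n, h])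
  refine ⟨fun n => ?_, Function.extend enc e 0, Function.extend enc f 0, ?_, ?_, fun x => ?_⟩
  · by_cases h : ∃ i, enc i = n
    · obtain ⟨i, rfl⟩ := h
      rw [henc.extend_apply]
      exact (hμ i).le
    · rw [Function.extend_apply' _ _ _ h]; simp
  · convert he.comp g hgi with n
    rw [← hg n, henc.extend_apply]; rfl
  · convert hf.comp g hgi with n
    rw [← hg n, henc.extend_apply]; rfl
  · convert (hasSum_extend_zero henc).2 (hU x) using 1
    ext n
    by_cases h : ∃ i, enc i = n
    · obtain ⟨i, rfl⟩ := h
      simp only [henc.extend_apply]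
    · simp only [Function.extend_apply' _ _ _ h]
      simp

end Schmidt

/-! ### From Gram-Schmidt bounds to Schatten classes -/

section Schatten

variable {𝕜 : Type*} [RCLike 𝕜] {H : Type*} [NormedAddCommGroup H] [InnerProductSpace 𝕜 H]

theorem schattenNorm_nonneg (p : ℝ≥0∞) (U : H →L[𝕜] H) : 0 ≤ schattenNorm p U := by
  unfold schattenNorm
  split_ifs
  · positivity
  · refine Real.sInf_nonneg ?_
    rintro _ ⟨μ, hμ, -, rfl⟩
    exact Real.rpow_nonneg (tsum_nonneg fun n => Real.rpow_nonneg (hμ.1 n) _) _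

theorem GramSchmidtBound.memSchatten [CompleteSpace H] {U : H →L[𝕜] H} {t c : ℝ} (ht : 0 ≤ t)
    (hc : 0 ≤ c) (h : GramSchmidtBound t c U) (hU : IsCompactOperator U) {p : ℝ≥0∞}
    (hp : p⁻¹ = ENNReal.ofReal t) : MemSchatten p U ∧ schattenNorm p U ≤ c := by
  rcases ht.eq_or_lt with rfl | ht
  · have : p = ⊤ := by simpa using hp
    subst this
    exact ⟨⟨hU, fun h => absurd rfl h⟩, by simpa [schattenNorm] using h.norm_le hc⟩
  have hp1 : p ≠ ⊤ := by
    rintro rfl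
    simp at hp
    linarith
  have hp2 : p.toReal = 1 / t := by
    rw [← inv_inv p, hp, ENNReal.toReal_inv, ENNReal.toReal_ofReal ht.le, one_div]
  obtain ⟨_, ι, μ, e, f, hμ, he, hf, hs⟩ := exists_schmidt_decomposition hU
  have hsum := h.sum_rpow_le ht hc (fun i => (hμ i).le) he hf (apply_of_hasSum_schmidt he hs)
  have hμ0 : ∀ i, 0 ≤ μ i ^ (1 / t) := fun i => Real.rpow_nonneg (hμ i).le _
  have hsm : Summable fun i => μ i ^ (1 / t) := summable_of_sum_le hμ0 hsum
  -- The Schmidt decomposition lives on an arbitrary index set; a summable family of positive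
  -- numbers forces it to be countable.
  have : Countable ι := by
    have := hsm.countable_support
    rw [Function.support_eq_univ fun i => (Real.rpow_pos_of_pos (hμ i) _).ne'] at this
    exact Set.countable_univ_iff.1 this
  obtain ⟨enc, henc⟩ := exists_injective_nat ι
  have hext : (fun n => Function.extend enc μ 0 n ^ p.toReal) =
      Function.extend enc (fun i => μ i ^ (1 / t)) 0 := by
    ext n
    rw [hp2]
    by_cases h : ∃ i, enc i = n
    · obtain ⟨i, rfl⟩ := h
      rw [henc.extend_apply, henc.extend_apply]
    · rw [Function.extend_apply' _ _ _ h, Function.extend_apply' _ _ _ h]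
      simp [ht.ne']
  have hS := isSingularSeq_extend henc hμ he hf hs
  have hhs : HasSum (fun n => Function.extend enc μ 0 n ^ p.toReal) (∑' i, μ i ^ (1 / t)) := by
    rw [hext, hasSum_extend_zero henc]
    exact hsm.hasSum
  refine ⟨⟨hU, fun _ => ⟨_, hS, hhs.summable⟩⟩, ?_⟩
  rw [schattenNorm, if_neg hp1]
  refine (csInf_le ⟨0, ?_⟩ (Set.mem_ofPred.2 ⟨_, hS, hhs.summable, rfl⟩)).trans ?_
  · rintro _ ⟨μ, hμ, -, rfl⟩
    exact Real.rpow_nonneg (tsum_nonneg fun n => Real.rpow_nonneg (hμ.1 n) _) _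
  · rw [hhs.tsum_eq, hp2, one_div_one_div]
    have := Real.rpow_le_rpow (tsum_nonneg hμ0) (hsm.tsum_le_of_sum_le hsum) ht.le
    rwa [← Real.rpow_mul hc, one_div_mul_cancel ht.ne', Real.rpow_one] at this

end Schatten

/-! ### Splitting a summable sequence into diagonal weights -/

section Sequences

/-- A convergent series of nonnegative terms remains convergent, with a sum as close as we like to
the old one, when divided by a suitable null sequence. -/
theorem exists_tendsto_zero_tsum_div_le {a : ℕ → ℝ} (ha : ∀ k, 0 ≤ a k) (hs : Summable a) {C : ℝ}
    (hC : ∑' k, a k < C) : ∃ η : ℕ → ℝ, (∀ k, 0 < η k) ∧ (∀ k, η k ≤ 1) ∧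
      Filter.Tendsto η Filter.atTop (nhds 0) ∧ (Summable fun k => a k / η k) ∧
      ∑' k, a k / η k ≤ C := by
  set r : ℕ → ℝ := fun k => ∑' i, a (i + k) with hr
  have hr0 : ∀ k, 0 ≤ r k := fun k => tsum_nonneg fun i => ha _
  have hstep : ∀ k, r k = a k + r (k + 1) := fun k => by
    rw [hr]
    beta_reduce
    rw [((summable_nat_add_iff k).2 hs).tsum_eq_zero_add, zero_add]
    simp only [add_assoc, add_comm 1 k]
  have hr00 : r 0 = ∑' k, a k := by simp [hr]
  have hrlim : Filter.Tendsto r Filter.atTop (nhds 0) := tendsto_sum_nat_add a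
  set D := C - r 0 with hD
  have hD0 : 0 < D := by linarith
  -- Chosen so that the telescoped loss `2 * K * √(r 0)` stays within the slack `D`; the `+ 1`
  -- covers `r 0 = 0`.
  set K := D / (2 * √(r 0) + 1) with hK
  have hs0 : 0 ≤ √(r 0) := Real.sqrt_nonneg _
  have hK0 : 0 < K := by positivity
  have hKD : 2 * K * √(r 0) ≤ D := by
    rw [hK]
    have : D / (2 * √(r 0) + 1) * (2 * √(r 0) + 1) = D := by field_simp
    nlinarith
  -- With `r` the tails, `a k = r k - r (k + 1)` is at most `2 √(r k) (√(r k) - √(r (k + 1)))`, so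
  -- dividing by `√(r k) / K` leaves a telescoping series. The term `1 / (k + 1)` keeps `η` positive
  -- when the tails vanish.
  set η : ℕ → ℝ := fun k => min 1 (√(r k) / K + 1 / ((k : ℝ) + 1)) with hη
  have hη0 : ∀ k, 0 < η k := fun k => lt_min one_pos (by positivity)
  have hterm : ∀ k, a k / η k ≤ a k + 2 * K * (√(r k) - √(r (k + 1))) := fun k => by
    have hmono : √(r (k + 1)) ≤ √(r k) := Real.sqrt_le_sqrt (by
      have := hstep k; have := ha k; linarith)
    have hd : a k = (√(r k) - √(r (k + 1))) * (√(r k) + √(r (k + 1))) := by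
      have h1 := Real.mul_self_sqrt (hr0 k)
      have h2 := Real.mul_self_sqrt (hr0 (k + 1))
      have := hstep k
      nlinarith
    rw [div_le_iff₀ (hη0 k)]
    set p := √(r k)
    set q := √(r (k + 1))
    have hp : 0 ≤ p := Real.sqrt_nonneg _
    have hq : 0 ≤ q := Real.sqrt_nonneg _
    rcases min_choice 1 (p / K + 1 / ((k : ℝ) + 1)) with h | h
    · have : η k = 1 := h
      rw [this]
      nlinarith [mul_nonneg hK0.le (sub_nonneg.2 hmono)]
    · have h3 : p / K ≤ η k := by
        rw [show η k = _ from h]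
        have : (0 : ℝ) ≤ 1 / ((k : ℝ) + 1) := by positivity
        linarith
      have h4 : p ≤ K * η k := by rwa [div_le_iff₀ hK0, mul_comm] at h3
      have h5 : 0 ≤ a k * η k := mul_nonneg (ha k) (hη0 k).le
      nlinarith [mul_le_mul_of_nonneg_left h4 (sub_nonneg.2 hmono)]
  have hpos : ∀ k, 0 ≤ a k / η k := fun k => div_nonneg (ha k) (hη0 k).le
  have hsum : ∀ n, ∑ k ∈ Finset.range n, a k / η k ≤ C := fun n => by
    calc ∑ k ∈ Finset.range n, a k / η k
        ≤ ∑ k ∈ Finset.range n, (a k + 2 * K * (√(r k) - √(r (k + 1)))) :=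
          Finset.sum_le_sum fun k _ => hterm k
      _ = ∑ k ∈ Finset.range n, a k + 2 * K * (√(r 0) - √(r n)) := by
          rw [Finset.sum_add_distrib, ← Finset.mul_sum,
            Finset.sum_range_sub' (fun k => √(r k))]
      _ ≤ C := by
          have h1 := hs.sum_le_tsum (Finset.range n) fun k _ => ha k
          have h2 : 0 ≤ 2 * K * √(r n) := by positivity
          linarith
  refine ⟨η, hη0, fun k => min_le_left _ _, ?_, summable_of_sum_range_le hpos hsum,
    Real.tsum_le_of_sum_range_le hpos hsum⟩
  have h1 : Filter.Tendsto (fun k : ℕ => √(r k) / K + 1 / ((k : ℝ) + 1)) Filter.atTop (nhds 0) := by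
    have := ((Real.continuous_sqrt.tendsto 0).comp hrlim).div_const K
    simpa using this.add tendsto_one_div_add_atTop_nhds_zero_nat
  exact squeeze_zero (fun k => (hη0 k).le) (fun k => min_le_right _ _) h1

/-- Here `a k ^ (1 / s)` will be `‖x' k‖ * ‖y k‖`. Its factors serve separate purposes: `η` gives
compactness, `β ^ (1 / s - 1)` the Schatten exponent, and `√β` and `c * √β` the square summability
of the outer maps. -/
theorem exists_diagonal_weights {a : ℕ → ℝ} (ha : ∀ k, 0 ≤ a k) (ha' : Summable a) {s c : ℝ}
    (hs0 : 0 < s) (hs1 : s ≤ 1) (hc : 0 < c) (hlt : ∑' k, a k < c ^ s) :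
    ∃ η β : ℕ → ℝ, (∀ k, |η k| ≤ 1) ∧ Filter.Tendsto η Filter.atTop (nhds 0) ∧
      (∀ k, 0 ≤ β k) ∧ (∀ k, β k ≤ 1) ∧ Summable β ∧ ∑' k, β k ≤ 1 ∧
      ∀ k, a k ^ (1 / s) = η k * β k ^ (1 / s - 1) * √(β k) * (c * √(β k)) := by
  have hcs : 0 < c ^ s := Real.rpow_pos_of_pos hc _
  obtain ⟨η, hη0, hη1, hηlim, hηs, hηt⟩ := exists_tendsto_zero_tsum_div_le ha ha' hlt
  set β : ℕ → ℝ := fun k => a k / η k / c ^ s with hβ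
  have hβ0 : ∀ k, 0 ≤ β k := fun k => div_nonneg (div_nonneg (ha k) (hη0 k).le) hcs.le
  have hβs : Summable β := hηs.div_const _
  have hβt : ∑' k, β k ≤ 1 := by
    rw [hβ, tsum_div_const]
    exact div_le_one_of_le₀ hηt hcs.le
  have ht : 0 ≤ 1 / s - 1 := by
    rw [sub_nonneg, le_div_iff₀ hs0]; linarith
  refine ⟨fun k => η k ^ (1 / s), β,
    abs_rpow_le_one (by positivity) (fun k => (hη0 k).le) hη1, ?_, hβ0,
    fun k => (hβs.le_tsum k fun i _ => hβ0 i).trans hβt, hβs, hβt, fun k => ?_⟩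
  · have := hηlim.rpow_const (p := 1 / s) (Or.inr (by positivity))
    rwa [Real.zero_rpow (by positivity)] at this
  · have h2 : a k = η k * β k * c ^ s := by
      have := (hη0 k).ne'
      rw [hβ]; field_simp
    have h3 : β k ^ (1 / s) = β k ^ (1 / s - 1) * β k := by
      conv_lhs => rw [← sub_add_cancel (1 / s) 1]
      rw [Real.rpow_add_of_nonneg (hβ0 k) ht zero_le_one, Real.rpow_one]
    rw [h2, Real.mul_rpow (mul_nonneg (hη0 k).le (hβ0 k)) hcs.le,
      Real.mul_rpow (hη0 k).le (hβ0 k), ← Real.rpow_mul hc.le, mul_one_div_cancel hs0.ne',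
      Real.rpow_one, h3]
    linear_combination (-(η k ^ (1 / s) * β k ^ (1 / s - 1) * c)) * Real.mul_self_sqrt (hβ0 k)

end Sequences

/-! ### Maps into and out of `ℓ²` with square summable coordinates -/

section SequenceSpaceMaps

variable {𝕜 : Type*} [RCLike 𝕜] {X Y : Type*}
  [NormedAddCommGroup X] [NormedSpace 𝕜 X] [NormedAddCommGroup Y] [NormedSpace 𝕜 Y] {ι : Type*}

theorem exists_clm_to_lp {φ : ι → X →L[𝕜] 𝕜} {C : ℝ} (hC : 0 ≤ C)
    (hs : Summable fun i => ‖φ i‖ ^ 2) (ht : ∑' i, ‖φ i‖ ^ 2 ≤ C ^ 2) :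
    ∃ A : X →L[𝕜] lp (fun _ : ι => 𝕜) 2, (∀ x i, A x i = φ i x) ∧ ‖A‖ ≤ C := by
  have hle : ∀ x i, ‖φ i x‖ ^ 2 ≤ ‖φ i‖ ^ 2 * ‖x‖ ^ 2 := fun x i => by
    rw [← mul_pow]
    exact pow_le_pow_left₀ (norm_nonneg _) ((φ i).le_opNorm x) 2
  have hsx : ∀ x, Summable fun i => ‖φ i x‖ ^ 2 := fun x =>
    (hs.mul_right (‖x‖ ^ 2)).of_nonneg_of_le (fun i => sq_nonneg _) (hle x)
  have hmem : ∀ x, Memℓp (fun i => φ i x) 2 := fun x => memℓp_gen (by simpa using hsx x)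
  let A : X →ₗ[𝕜] lp (fun _ : ι => 𝕜) 2 :=
    { toFun := fun x => ⟨fun i => φ i x, hmem x⟩
      map_add' := fun x y => by
        ext i
        exact map_add (φ i) x y
      map_smul' := fun a x => by
        ext i
        exact map_smul (φ i) a x }
  have hA : ∀ x, ‖A x‖ ≤ C * ‖x‖ := fun x => by
    refine abs_le_of_sq_le_sq' ?_ (by positivity) |>.2
    rw [← (hasSum_norm_sq (A x)).tsum_eq, mul_pow]
    refine ((hsx x).tsum_le_tsum (hle x) (hs.mul_right _)).trans ?_
    rw [tsum_mul_right]
    gcongr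
  exact ⟨A.mkContinuous C hA, fun x i => rfl, A.mkContinuous_norm_le hC hA⟩

theorem exists_clm_of_lp [CompleteSpace Y] {y : ι → Y} {C : ℝ} (hC : 0 ≤ C)
    (hs : Summable fun i => ‖y i‖ ^ 2) (ht : ∑' i, ‖y i‖ ^ 2 ≤ C ^ 2) :
    ∃ B : lp (fun _ : ι => 𝕜) 2 →L[𝕜] Y, (∀ f, HasSum (fun i => f i • y i) (B f)) ∧ ‖B‖ ≤ C := by
  have hb : ∀ f : lp (fun _ : ι => 𝕜) 2, Summable (fun i => ‖f i‖ * ‖y i‖) ∧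
      ∑' i, ‖f i‖ * ‖y i‖ ≤ C * ‖f‖ := fun f => by
    have h := Real.summable_and_inner_le_Lp_mul_Lq_tsum_of_nonneg Real.HolderConjugate.two_two
      (fun i => norm_nonneg (f i)) (fun i => norm_nonneg (y i))
      (by simpa using (hasSum_norm_sq f).summable) (by simpa using hs)
    refine ⟨h.1, h.2.trans ?_⟩
    simp only [Real.rpow_two, ← Real.sqrt_eq_rpow, (hasSum_norm_sq f).tsum_eq,
      Real.sqrt_sq (norm_nonneg f)]
    rw [mul_comm]
    exact mul_le_mul_of_nonneg_right (Real.sqrt_le_iff.2 ⟨hC, ht⟩) (norm_nonneg _)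
  have hsm : ∀ f : lp (fun _ : ι => 𝕜) 2, Summable fun i => f i • y i := fun f =>
    .of_norm (by simpa only [norm_smul] using (hb f).1)
  let B : lp (fun _ : ι => 𝕜) 2 →ₗ[𝕜] Y :=
    { toFun := fun f => ∑' i, f i • y i
      map_add' := fun f g => by
        rw [← (hsm f).tsum_add (hsm g)]
        exact tsum_congr fun i => add_smul _ _ _
      map_smul' := fun a f => by
        rw [RingHom.id_apply, ← (hsm f).tsum_const_smul]
        exact tsum_congr fun i => mul_smul _ _ _ }
  have hB : ∀ f, ‖B f‖ ≤ C * ‖f‖ := fun f => by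
    refine (norm_tsum_le_tsum_norm (by simpa only [norm_smul] using (hb f).1)).trans ?_
    simpa only [norm_smul] using (hb f).2
  exact ⟨B.mkContinuous C hB, fun f => (hsm f).hasSum, B.mkContinuous_norm_le hC hB⟩

/-- The standard basis of `ℓ²`. -/
def lpBasis (𝕜 ι : Type*) [RCLike 𝕜] : HilbertBasis ι 𝕜 (lp (fun _ : ι => 𝕜) 2) :=
  .ofRepr (LinearIsometryEquiv.refl 𝕜 _)

theorem lpBasis_apply [DecidableEq ι] (i : ι) : lpBasis 𝕜 ι i = lp.single 2 i (1 : 𝕜) :=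
  ((lpBasis 𝕜 ι).repr_symm_single i).symm

end SequenceSpaceMaps

/-! ### Factorization of a single nuclear operator -/

section NuclearFactorization

variable {𝕜 : Type*} [RCLike 𝕜] {X Y : Type*}
  [NormedAddCommGroup X] [NormedSpace 𝕜 X] [NormedAddCommGroup Y] [NormedSpace 𝕜 Y]

theorem exists_norm_le_one_smul (z : X) : ∃ z' : X, ‖z'‖ ≤ 1 ∧ z = (‖z‖ : 𝕜) • z' := by
  by_cases h : z = 0
  · exact ⟨0, by simp, by simp [h]⟩
  · have h' : (‖z‖ : 𝕜) ≠ 0 := by simpa using h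
    refine ⟨(‖z‖ : 𝕜)⁻¹ • z, ?_, by rw [smul_smul, mul_inv_cancel₀ h', one_smul]⟩
    rw [norm_smul, norm_inv, RCLike.norm_ofReal, abs_norm, inv_mul_cancel₀ (by simpa using h)]

/-- An `s`-nuclear operator factors through `ℓ²` by a compact diagonal operator. -/
theorem IsSNuclear.exists_factorization [CompleteSpace Y] {s c : ℝ} (hs0 : 0 < s) (hs1 : s ≤ 1)
    {T : X →L[𝕜] Y} (hT : IsSNuclear s T) (hc : nuclearQuasinorm s T < c) :
    ∃ (A : X →L[𝕜] lp (fun _ : ℕ => 𝕜) 2)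
      (D : lp (fun _ : ℕ => 𝕜) 2 →L[𝕜] lp (fun _ : ℕ => 𝕜) 2)
      (B : lp (fun _ : ℕ => 𝕜) 2 →L[𝕜] Y), T = B ∘L D ∘L A ∧ ‖A‖ ≤ 1 ∧ ‖B‖ ≤ c ∧
      (Summable fun i => ‖B (lpBasis 𝕜 ℕ i)‖ ^ 2) ∧ ∑' i, ‖B (lpBasis 𝕜 ℕ i)‖ ^ 2 ≤ c ^ 2 ∧
      IsCompactOperator D ∧ GramSchmidtBound (1 / s - 1) 1 D := by
  obtain ⟨_, ⟨x', y, ⟨hsum, hrep⟩, rfl⟩, hlt⟩ := exists_lt_of_csInf_lt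
    (by obtain ⟨x', y, h⟩ := hT; exact ⟨_, x', y, h, rfl⟩) hc
  set a : ℕ → ℝ := fun k => ‖x' k‖ ^ s * ‖y k‖ ^ s with ha
  have ha0 : ∀ k, 0 ≤ a k := fun k =>
    mul_nonneg (Real.rpow_nonneg (norm_nonneg _) _) (Real.rpow_nonneg (norm_nonneg _) _)
  have hsa0 : 0 ≤ ∑' k, a k := tsum_nonneg ha0
  have hc0 : 0 < c := (Real.rpow_nonneg hsa0 _).trans_lt hlt
  have hlt' : ∑' k, a k < c ^ s := by
    have := Real.rpow_lt_rpow (Real.rpow_nonneg hsa0 _) hlt hs0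
    rwa [← Real.rpow_mul hsa0, one_div_mul_cancel hs0.ne', Real.rpow_one] at this
  have ht : 0 ≤ 1 / s - 1 := by
    rw [sub_nonneg, le_div_iff₀ hs0]; linarith
  obtain ⟨η, β, hη1, hηlim, hβ0, hβ1, hβs, hβt, hδ⟩ :=
    exists_diagonal_weights ha0 hsum hs0 hs1 hc0 hlt'
  choose u hu1 hu using fun k => exists_norm_le_one_smul (𝕜 := 𝕜) (x' k)
  choose w hw1 hw using fun k => exists_norm_le_one_smul (𝕜 := 𝕜) (y k)
  have hφ : ∀ k, ‖((√(β k) : ℝ) : 𝕜) • u k‖ ^ 2 ≤ β k := fun k => by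
    rw [norm_smul, mul_pow, RCLike.norm_ofReal, sq_abs, Real.sq_sqrt (hβ0 k)]
    exact mul_le_of_le_one_right (hβ0 k) (pow_le_one₀ (norm_nonneg _) (hu1 k))
  have hy : ∀ k, ‖((c * √(β k) : ℝ) : 𝕜) • w k‖ ^ 2 ≤ c ^ 2 * β k := fun k => by
    rw [norm_smul, mul_pow, RCLike.norm_ofReal, sq_abs, mul_pow, Real.sq_sqrt (hβ0 k)]
    exact mul_le_of_le_one_right (mul_nonneg (sq_nonneg c) (hβ0 k))
      (pow_le_one₀ (norm_nonneg _) (hw1 k))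
  have hφs : Summable fun k => ‖((√(β k) : ℝ) : 𝕜) • u k‖ ^ 2 :=
    hβs.of_nonneg_of_le (fun k => sq_nonneg _) hφ
  have hys : Summable fun k => ‖((c * √(β k) : ℝ) : 𝕜) • w k‖ ^ 2 :=
    (hβs.mul_left (c ^ 2)).of_nonneg_of_le (fun k => sq_nonneg _) hy
  have hyt : ∑' k, ‖((c * √(β k) : ℝ) : 𝕜) • w k‖ ^ 2 ≤ c ^ 2 := by
    refine (hys.tsum_le_tsum hy (hβs.mul_left _)).trans ?_
    rw [tsum_mul_left]
    exact mul_le_of_le_one_right (sq_nonneg c) hβt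
  obtain ⟨A, hA, hA1⟩ := exists_clm_to_lp zero_le_one hφs
    (by simpa using (hφs.tsum_le_tsum hφ hβs).trans hβt)
  obtain ⟨B, hB, hBc⟩ := exists_clm_of_lp (𝕜 := 𝕜) hc0.le hys hyt
  have hBe : ∀ i, B (lpBasis 𝕜 ℕ i) = ((c * √(β i) : ℝ) : 𝕜) • w i := fun i => by
    refine (hB _).unique ?_
    convert hasSum_ite_eq i (((c * √(β i) : ℝ) : 𝕜) • w i) using 2 with j
    rw [lpBasis_apply, lp.single_apply, Pi.single_apply]
    split_ifs with h
    · rw [h, one_smul]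
    · rw [zero_smul]
  -- For `s = 1` the diagonal `β ^ (1 / s - 1)` is the identity, so compactness has to come from the
  -- null sequence `η`.
  have hD := isCompactOperator_lpDiagonal (𝕜 := 𝕜) η hη1 hηlim
  have hDb : GramSchmidtBound 0 1 (lpDiagonal (𝕜 := 𝕜) η hη1) :=
    .of_norm_le (norm_lpDiagonal_le η hη1 zero_le_one hη1)
  have hDβ := gramSchmidtBound_lpDiagonal (𝕜 := 𝕜) ht hβ0 hβ1 hβs hβt
  refine ⟨A, lpDiagonal η hη1 ∘L
    lpDiagonal (fun k => β k ^ (1 / s - 1)) (abs_rpow_le_one ht hβ0 hβ1), B, ?_, hA1, hBc, ?_, ?_,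
    hD.comp_clm _, ?_⟩
  · ext x
    refine (hrep x).unique ?_
    have hBx := hB ((lpDiagonal η hη1 ∘L
      lpDiagonal (fun k => β k ^ (1 / s - 1)) (abs_rpow_le_one ht hβ0 hβ1)) (A x))
    have key : ∀ k, x' k x • y k = (lpDiagonal η hη1 (lpDiagonal (fun k => β k ^ (1 / s - 1))
        (abs_rpow_le_one ht hβ0 hβ1) (A x)) k) • (((c * √(β k) : ℝ) : 𝕜) • w k) := fun k => by
      rw [lpDiagonal_apply, lpDiagonal_apply, hA, smul_smul, hw k, smul_smul]
      congr 1
      have h1 : ‖x' k‖ * ‖y k‖ = a k ^ (1 / s) := by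
        rw [ha]
        beta_reduce
        rw [← Real.mul_rpow (norm_nonneg _) (norm_nonneg _), ← Real.rpow_mul (by positivity),
          mul_one_div_cancel hs0.ne', Real.rpow_one]
      have h2 : x' k x = (‖x' k‖ : 𝕜) * u k x := by
        conv_lhs => rw [hu k]
        rfl
      have h3 : (((√(β k) : ℝ) : 𝕜) • u k) x = ((√(β k) : ℝ) : 𝕜) * u k x := rfl
      have h4 := congrArg (fun z : ℝ => (z : 𝕜)) (h1.trans (hδ k))
      rw [h2, h3]
      push_cast at h4 ⊢
      linear_combination (u k x) * h4
    simp only [key]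
    exact hBx
  · simpa only [hBe] using hys
  · simpa only [hBe] using hyt
  · have h2 := hDβ.comp ht le_rfl zero_le_one zero_le_one hDb
    rwa [zero_add, one_mul] at h2

end NuclearFactorization

/-! ### Products of nuclear operators through `ℓ²` -/

section ProductFactorization

variable {𝕜 : Type*} [RCLike 𝕜]

theorem partialProduct_zero {n : ℕ} {X : Fin (n + 1) → Type*} [∀ i, NormedAddCommGroup (X i)]
    [∀ i, NormedSpace 𝕜 (X i)] (T : ∀ k : Fin n, X k.castSucc →L[𝕜] X k.succ) :
    partialProduct T 0 = ContinuousLinearMap.id 𝕜 (X 0) := rfl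

theorem partialProduct_succ {n : ℕ} {X : Fin (n + 1) → Type*} [∀ i, NormedAddCommGroup (X i)]
    [∀ i, NormedSpace 𝕜 (X i)] (T : ∀ k : Fin n, X k.castSucc →L[𝕜] X k.succ) (k : Fin n) :
    partialProduct T k.succ = T k ∘L partialProduct T k.castSucc := rfl

/-- `S = B U A` through `ℓ²`, where `U` is compact with a Gram-Schmidt bound and `B` is a
Hilbert-Schmidt type map. -/
def HasL2Factorization {X Y : Type*} [NormedAddCommGroup X] [NormedSpace 𝕜 X]
    [NormedAddCommGroup Y] [NormedSpace 𝕜 Y] (t c : ℝ) (S : X →L[𝕜] Y) : Prop :=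
  ∃ (A : X →L[𝕜] lp (fun _ : ℕ => 𝕜) 2)
    (U : lp (fun _ : ℕ => 𝕜) 2 →L[𝕜] lp (fun _ : ℕ => 𝕜) 2)
    (B : lp (fun _ : ℕ => 𝕜) 2 →L[𝕜] Y) (γ β : ℝ), S = B ∘L U ∘L A ∧ 0 ≤ γ ∧ 0 ≤ β ∧
    β * γ ≤ c ∧ ‖A‖ ≤ 1 ∧ ‖B‖ ≤ β ∧ (Summable fun i => ‖B (lpBasis 𝕜 ℕ i)‖ ^ 2) ∧
    ∑' i, ‖B (lpBasis 𝕜 ℕ i)‖ ^ 2 ≤ β ^ 2 ∧ IsCompactOperator U ∧ GramSchmidtBound t γ U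

section

variable {X Y Z : Type*} [NormedAddCommGroup X] [NormedSpace 𝕜 X] [NormedAddCommGroup Y]
  [NormedSpace 𝕜 Y] [NormedAddCommGroup Z] [NormedSpace 𝕜 Z]

theorem IsSNuclear.hasL2Factorization_comp [CompleteSpace Z] {s c : ℝ} (hs0 : 0 < s) (hs1 : s ≤ 1)
    (hc0 : 0 ≤ c) {T : Y →L[𝕜] Z} (hT : IsSNuclear s T) (hc : nuclearQuasinorm s T < c)
    {S : X →L[𝕜] Y} (hS : ‖S‖ ≤ 1) : HasL2Factorization (1 / s - 1) c (T ∘L S) := by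
  obtain ⟨A, D, B, hTe, hA, hB, hBs, hBt, hDc, hDb⟩ := hT.exists_factorization hs0 hs1 hc
  refine ⟨A ∘L S, D, B, 1, c, by rw [hTe]; rfl, zero_le_one, hc0, (mul_one c).le, ?_, hB, hBs, hBt,
    hDc, hDb⟩
  exact (A.opNorm_comp_le S).trans (mul_le_one₀ hA (norm_nonneg _) hS)

/-- In `B D (A B') U A'` the map `A B'` is Hilbert-Schmidt because `B'` is square summable on the
basis and `‖A‖ ≤ 1`. It contributes the exponent `1 / 2`, and `B` is again square summable, so the
step can be repeated. -/
theorem HasL2Factorization.comp [CompleteSpace Z] {s c t c' : ℝ} (hs0 : 0 < s) (hs1 : s ≤ 1)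
    (ht : 0 ≤ t) (hc0 : 0 ≤ c) {T : Y →L[𝕜] Z} (hT : IsSNuclear s T)
    (hc : nuclearQuasinorm s T < c) {S : X →L[𝕜] Y} (hS : HasL2Factorization t c' S) :
    HasL2Factorization (1 / s - 1 + (1 / 2 + t)) (c * c') (T ∘L S) := by
  obtain ⟨A', U, B', γ, β, hSe, hγ, hβ, hβγ, hA', hB', hBs', hBt', hU, hUb⟩ := hS
  obtain ⟨A, D, B, hTe, hA, hB, hBs, hBt, hDc, hDb⟩ := hT.exists_factorization hs0 hs1 hc
  have hle : ∀ i, ‖(A ∘L B') (lpBasis 𝕜 ℕ i)‖ ^ 2 ≤ ‖B' (lpBasis 𝕜 ℕ i)‖ ^ 2 := fun i =>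
    pow_le_pow_left₀ (norm_nonneg _) ((A.le_opNorm _).trans
      (mul_le_of_le_one_left (norm_nonneg _) hA)) 2
  have hsum := hBs'.of_nonneg_of_le (fun i => sq_nonneg _) hle
  have hAB : GramSchmidtBound (1 / 2) β (A ∘L B') := .of_basis (lpBasis 𝕜 ℕ) hβ hsum
    ((hsum.tsum_le_tsum hle hBs').trans hBt')
  have hs : 0 ≤ 1 / s - 1 := by
    rw [sub_nonneg, le_div_iff₀ hs0]; linarith
  have hV := (hUb.comp ht (by norm_num) hγ hβ hAB).comp (by positivity) hs (by positivity)
    zero_le_one hDb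
  refine ⟨A', D ∘L (A ∘L B') ∘L U, B, 1 * (β * γ), c, by rw [hTe, hSe]; rfl, by positivity, hc0,
    ?_, hA', hB, hBs, hBt, hDc.comp_clm _, hV⟩
  rw [one_mul]
  gcongr

end

/-- The empty product is the identity, for which only the norm bound is available. The first
operator contributes `1 / s - 1` and each later one `1 / s - 1 / 2`, whence `(j + 1) / 2`. -/
theorem hasL2Factorization_partialProduct {n : ℕ} {X : Fin (n + 1) → Type*}
    [∀ i, NormedAddCommGroup (X i)] [∀ i, NormedSpace 𝕜 (X i)] [∀ i, CompleteSpace (X i)]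
    {T : ∀ k : Fin n, X k.castSucc →L[𝕜] X k.succ} {s c : Fin n → ℝ}
    (hs : ∀ k, 0 < s k ∧ s k ≤ 1) (hT : ∀ k, IsSNuclear (s k) (T k)) (hc0 : ∀ k, 0 ≤ c k)
    (hc : ∀ k, nuclearQuasinorm (s k) (T k) < c k) (j : Fin (n + 1)) :
    (j = 0 ∧ ‖partialProduct T j‖ ≤ 1) ∨ ∃ t, 0 ≤ t ∧
      t = ∑ k with Fin.castSucc k < j, 1 / s k - ((j : ℝ) + 1) / 2 ∧
      HasL2Factorization t (∏ k with Fin.castSucc k < j, c k) (partialProduct T j) := by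
  classical
  induction j using Fin.induction with
  | zero => exact .inl ⟨rfl, by rw [partialProduct_zero]; exact ContinuousLinearMap.norm_id_le⟩
  | succ k ih =>
    right
    have hs1 : 0 ≤ 1 / s k - 1 := by
      rw [sub_nonneg, le_div_iff₀ (hs k).1]; linarith [(hs k).2]
    have hfil : (Finset.univ.filter fun i : Fin n => i.castSucc < k.succ) =
        insert k (Finset.univ.filter fun i : Fin n => i.castSucc < k.castSucc) := by
      ext i
      simp only [Finset.mem_filter, Finset.mem_univ, true_and, Finset.mem_insert, Fin.lt_def,
        Fin.val_castSucc, Fin.val_succ, Fin.ext_iff]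
      omega
    have hk : k ∉ Finset.univ.filter fun i : Fin n => i.castSucc < k.castSucc := by simp
    rw [hfil, Finset.sum_insert hk, Finset.prod_insert hk, partialProduct_succ]
    rcases ih with ⟨h0, h1⟩ | ⟨t, ht, hte, hF⟩
    · refine ⟨1 / s k - 1, hs1, ?_, ?_⟩
      · have : (k : ℕ) = 0 := by simpa [Fin.ext_iff] using h0
        simp [h0, this]
      · have := (hT k).hasL2Factorization_comp (hs k).1 (hs k).2 (hc0 k) (hc k) h1
        simpa [h0] using this
    · refine ⟨_, by positivity, ?_, hF.comp (hs k).1 (hs k).2 ht (hc0 k) (hT k) (hc k)⟩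
      rw [hte]
      simp only [Fin.val_castSucc, Fin.val_succ]
      push_cast
      ring

theorem hasL2Factorization_operatorProduct {n : ℕ} (hn : 1 ≤ n) {X : Fin (n + 1) → Type*}
    [∀ i, NormedAddCommGroup (X i)] [∀ i, NormedSpace 𝕜 (X i)] [∀ i, CompleteSpace (X i)]
    {T : ∀ k : Fin n, X k.castSucc →L[𝕜] X k.succ} {s c : Fin n → ℝ}
    (hs : ∀ k, 0 < s k ∧ s k ≤ 1) (hT : ∀ k, IsSNuclear (s k) (T k)) (hc0 : ∀ k, 0 ≤ c k)
    (hc : ∀ k, nuclearQuasinorm (s k) (T k) < c k) :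
    0 ≤ ∑ k, 1 / s k - ((n : ℝ) + 1) / 2 ∧
      HasL2Factorization (∑ k, 1 / s k - ((n : ℝ) + 1) / 2) (∏ k, c k) (operatorProduct T) := by
  rcases hasL2Factorization_partialProduct hs hT hc0 hc (Fin.last n) with ⟨h, -⟩ | ⟨t, ht, hte, h⟩
  · rw [Fin.ext_iff] at h
    simp at h
    omega
  · simp only [Fin.castSucc_lt_last, Finset.filter_true, Fin.val_last] at hte h
    subst hte
    exact ⟨ht, h⟩

end ProductFactorization

/-! ### Transfer from `ℓ²` to an arbitrary infinite-dimensional Hilbert space -/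

section Transfer

variable {𝕜 : Type*} [RCLike 𝕜] {H : Type*} [NormedAddCommGroup H] [InnerProductSpace 𝕜 H]

theorem exists_linearIsometry_lp [CompleteSpace H] (hH : ¬ FiniteDimensional 𝕜 H) :
    Nonempty (lp (fun _ : ℕ => 𝕜) 2 →ₗᵢ[𝕜] H) := by
  set b := Module.Basis.ofVectorSpace 𝕜 H
  have : Infinite (Module.Basis.ofVectorSpaceIndex 𝕜 H) := by
    by_contra h
    rw [not_infinite_iff_finite] at h
    exact hH (Module.Finite.of_basis b)
  have hli := b.linearIndependent.comp _ (Infinite.natEmbedding _).injective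
  exact ⟨(gramSchmidtNormed_orthonormal hli).orthogonalFamily.linearIsometry⟩

variable {X Y : Type*} [NormedAddCommGroup X] [NormedSpace 𝕜 X]
  [NormedAddCommGroup Y] [NormedSpace 𝕜 Y]

/-- For an isometry `j` of `ℓ²` into `H`, the operator `U` is replaced by `j U j*`; since `j* j =
1`, the product is unchanged and no norm grows. -/
theorem HasL2Factorization.schattenFactorization [CompleteSpace H] (hH : ¬ FiniteDimensional 𝕜 H)
    {t c : ℝ} (ht : 0 ≤ t) {p : ℝ≥0∞} (hp : p⁻¹ = ENNReal.ofReal t) {S : X →L[𝕜] Y}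
    (hS : HasL2Factorization t c S) :
    FactorsThroughSchatten H p S ∧ schattenFactorNorm H p S ≤ c := by
  obtain ⟨J⟩ := exists_linearIsometry_lp (𝕜 := 𝕜) hH
  obtain ⟨A, U, B, γ, β, hSe, hγ, hβ, hβγ, hA, hB, -, -, hU, hUb⟩ := hS
  set j := J.toContinuousLinearMap with hj
  have hj1 : ‖j‖ ≤ 1 := J.norm_toContinuousLinearMap_le
  have hj1' : ‖j.adjoint‖ ≤ 1 := by
    rw [LinearIsometryEquiv.norm_map]; exact hj1
  have hjj : ∀ x, j.adjoint (j x) = x := fun x =>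
    congrArg (fun f => f x) J.adjoint_comp_self
  have hc1 : IsCompactOperator (j ∘L U ∘L j.adjoint) := (hU.comp_clm j.adjoint).clm_comp j
  have hb1 : GramSchmidtBound t γ (j ∘L U ∘L j.adjoint) := by
    have h1 := GramSchmidtBound.comp le_rfl ht zero_le_one hγ (.of_norm_le hj1') hUb
    have h2 := h1.comp (by positivity) le_rfl (by positivity) zero_le_one (.of_norm_le hj1)
    simpa using h2
  obtain ⟨hm, hn⟩ := hb1.memSchatten ht hγ hc1 hp
  have hfac : IsSchattenFactorization H p S (j ∘L A) (j ∘L U ∘L j.adjoint) (B ∘L j.adjoint) := by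
    refine ⟨hm, ?_⟩
    ext x
    simp [hSe, hjj]
  refine ⟨⟨_, _, _, hfac⟩, ?_⟩
  refine (csInf_le ⟨0, ?_⟩ (Set.mem_ofPred.2 ⟨_, _, _, hfac, rfl⟩)).trans ?_
  · rintro _ ⟨A, U, B, -, rfl⟩
    have := schattenNorm_nonneg p U
    positivity
  · have h1 : ‖j ∘L A‖ ≤ 1 := (j.opNorm_comp_le A).trans (mul_le_one₀ hj1 (norm_nonneg _) hA)
    have h2 : ‖B ∘L j.adjoint‖ ≤ β := (B.opNorm_comp_le _).trans
      ((mul_le_of_le_one_right (norm_nonneg _) hj1').trans hB)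
    have h3 := schattenNorm_nonneg p (j ∘L U ∘L j.adjoint)
    calc ‖j ∘L A‖ * schattenNorm p (j ∘L U ∘L j.adjoint) * ‖B ∘L j.adjoint‖
        ≤ 1 * γ * β := by gcongr
      _ = β * γ := by ring
      _ ≤ c := hβγ

end Transfer

theorem nuclearQuasinorm_nonneg {𝕜 : Type*} [RCLike 𝕜] {X Y : Type*} [NormedAddCommGroup X]
    [NormedSpace 𝕜 X] [NormedAddCommGroup Y] [NormedSpace 𝕜 Y] (s : ℝ) (T : X →L[𝕜] Y) :
    0 ≤ nuclearQuasinorm s T := by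
  refine Real.sInf_nonneg ?_
  rintro _ ⟨x', y, -, rfl⟩
  exact Real.rpow_nonneg (tsum_nonneg fun n => mul_nonneg (Real.rpow_nonneg (norm_nonneg _) _)
    (Real.rpow_nonneg (norm_nonneg _) _)) _

/-- A product of nuclear operators factors through a Schatten class operator. -/
theorem operatorProduct_schattenFactorization {𝕜 : Type*} [RCLike 𝕜] {H : Type*}
    [NormedAddCommGroup H] [InnerProductSpace 𝕜 H] [CompleteSpace H]
    (hH : ¬ FiniteDimensional 𝕜 H) {n : ℕ} (hn : 1 ≤ n) {X : Fin (n + 1) → Type*}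
    [∀ i, NormedAddCommGroup (X i)] [∀ i, NormedSpace 𝕜 (X i)] [∀ i, CompleteSpace (X i)]
    {T : ∀ k : Fin n, X k.castSucc →L[𝕜] X k.succ} {s : Fin n → ℝ}
    (hs : ∀ k, 0 < s k ∧ s k ≤ 1) (hT : ∀ k, IsSNuclear (s k) (T k)) {r : ℝ≥0∞}
    (hr : r⁻¹ = ENNReal.ofReal ((∑ k, 1 / s k) - ((n : ℝ) + 1) / 2)) :
    FactorsThroughSchatten H r (operatorProduct T) ∧
      schattenFactorNorm H r (operatorProduct T) ≤ ∏ k, nuclearQuasinorm (s k) (T k) := by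
  -- The quasinorms are infima that need not be attained, so they are approached from above.
  have key : ∀ ε : ℝ, 0 < ε → FactorsThroughSchatten H r (operatorProduct T) ∧
      schattenFactorNorm H r (operatorProduct T) ≤ ∏ k, (nuclearQuasinorm (s k) (T k) + ε) :=
    fun ε hε => by
      obtain ⟨ht, h⟩ := hasL2Factorization_operatorProduct hn hs hT
        (c := fun k => nuclearQuasinorm (s k) (T k) + ε)
        (fun k => add_nonneg (nuclearQuasinorm_nonneg _ _) hε.le) fun k => lt_add_of_pos_right _ hε
      exact h.schattenFactorization hH ht hr
  refine ⟨(key 1 one_pos).1, ?_⟩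
  have hlim : Filter.Tendsto (fun ε : ℝ => ∏ k, (nuclearQuasinorm (s k) (T k) + ε))
      (nhdsWithin 0 (Set.Ioi 0)) (nhds (∏ k, nuclearQuasinorm (s k) (T k))) := by
    have hcont : Continuous fun ε : ℝ => ∏ k, (nuclearQuasinorm (s k) (T k) + ε) := by fun_prop
    have := hcont.tendsto 0
    simp only [add_zero] at this
    exact this.mono_left nhdsWithin_le_nhds
  exact ge_of_tendsto hlim (Filter.eventually_of_mem self_mem_nhdsWithin fun ε hε => (key ε hε).2)

/-! ### From Schatten classes to Gram-Schmidt bounds; sign averaging -/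

section SchattenBound

variable {𝕜 : Type*} [RCLike 𝕜] {H : Type*} [NormedAddCommGroup H] [InnerProductSpace 𝕜 H]

theorem adjoint_linearIsometry_apply [CompleteSpace H] {ι : Type*} {e : ι → H}
    (he : Orthonormal 𝕜 e) (x : H) (i : ι) :
    he.orthogonalFamily.linearIsometry.toContinuousLinearMap.adjoint x i = inner 𝕜 (e i) x := by
  classical
  rw [← inner_single_one, ContinuousLinearMap.adjoint_inner_right]
  congr 1
  refine (he.orthogonalFamily.linearIsometry_apply_single (i := i) (1 : 𝕜)).trans ?_
  simp

/-- The Schmidt decomposition writes `U` as a diagonal operator between a partial isometry and a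
scaled isometry. -/
theorem gramSchmidtBound_of_isSingularSeq [CompleteSpace H] {U : H →L[𝕜] H} {μ : ℕ → ℝ}
    (hU : IsSingularSeq U μ) {p : ℝ} (hp : 0 < p) (hs : Summable fun n => μ n ^ p) :
    ∃ C, 0 ≤ C ∧ GramSchmidtBound (1 / p) C U := by
  obtain ⟨hμ, e, f, he, hf, hsum⟩ := hU
  -- The `+ 1` keeps `M` positive when `U = 0`.
  set M := ∑' n : {n // 0 < μ n}, μ n ^ p + 1 with hM
  have hμp : ∀ n, 0 ≤ μ n ^ p := fun n => Real.rpow_nonneg (hμ n) _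
  have hM0 : 0 < M := add_pos_of_nonneg_of_pos (tsum_nonneg fun n => hμp n) one_pos
  set δ : {n // 0 < μ n} → ℝ := fun n => μ n ^ p / M with hδ
  have hδ0 : ∀ n, 0 ≤ δ n := fun n => div_nonneg (hμp n) hM0.le
  have hδs : Summable δ := (hs.subtype _).div_const M
  have hδt : ∑' n, δ n ≤ 1 := by
    rw [hδ, tsum_div_const]
    exact div_le_one_of_le₀ (by linarith) hM0.le
  have hδ1 : ∀ n, δ n ≤ 1 := fun n => (hδs.le_tsum n fun i _ => hδ0 i).trans hδt
  have hp' : 0 ≤ 1 / p := by positivity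
  have hD := gramSchmidtBound_lpDiagonal (𝕜 := 𝕜) hp' hδ0 hδ1 hδs hδt
  set E := he.orthogonalFamily.linearIsometry.toContinuousLinearMap with hE
  set F := hf.orthogonalFamily.linearIsometry.toContinuousLinearMap with hF
  have hE1 : ‖E.adjoint‖ ≤ 1 := by
    rw [LinearIsometryEquiv.norm_map]
    exact he.orthogonalFamily.linearIsometry.norm_toContinuousLinearMap_le
  set σ := M ^ (1 / p) with hσ
  have hσ0 : 0 ≤ σ := Real.rpow_nonneg hM0.le _
  have hF1 : ‖(σ : 𝕜) • F‖ ≤ σ := by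
    rw [norm_smul, RCLike.norm_ofReal, abs_of_nonneg hσ0]
    exact mul_le_of_le_one_right hσ0
      hf.orthogonalFamily.linearIsometry.norm_toContinuousLinearMap_le
  have hb := (GramSchmidtBound.comp le_rfl hp' zero_le_one zero_le_one
    (.of_norm_le hE1) hD).comp (by positivity) le_rfl (by positivity) hσ0 (.of_norm_le hF1)
  refine ⟨σ, hσ0, ?_⟩
  convert hb using 1
  · ring
  · ring
  · ext x
    have h1 := hf.orthogonalFamily.hasSum_linearIsometry
      (lpDiagonal (fun n => δ n ^ (1 / p)) (abs_rpow_le_one hp' hδ0 hδ1) (E.adjoint x))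
    have h2 := h1.const_smul (σ : 𝕜)
    have h3 := (hasSum_subtype_iff_of_support_subset (s := {n | 0 < μ n}) fun n hn => ?_).2 (hsum x)
    · refine h3.unique ?_
      refine Eq.mp ?_ h2
      congr 1
      ext n
      rw [lpDiagonal_apply, hE, adjoint_linearIsometry_apply he, LinearIsometry.toSpanSingleton_apply,
        smul_smul, Function.comp_apply]
      congr 1
      have h4 : μ n = σ * δ n ^ (1 / p) := by
        rw [hσ, hδ, Real.div_rpow (hμp n) hM0.le, mul_div_cancel₀ _
          (Real.rpow_pos_of_pos hM0 _).ne', ← Real.rpow_mul (hμ n), mul_one_div_cancel hp.ne',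
          Real.rpow_one]
      rw [h4]
      push_cast
      ring
    · refine (hμ n).lt_of_ne fun h0 => ?_
      simp [← h0] at hn

/-- Some choice of signs makes the norm of a signed sum at least the Hilbert-Schmidt sum. -/
theorem exists_signs_sum_norm_sq_le {α : Type*} (s : Finset α) (w : α → H) :
    ∃ ε : α → 𝕜, (∀ a, ‖ε a‖ ≤ 1) ∧ ∑ a ∈ s, ‖w a‖ ^ 2 ≤ ‖∑ a ∈ s, ε a • w a‖ ^ 2 := by
  classical
  induction s using Finset.induction_on with
  | empty => exact ⟨0, by simp, by simp⟩
  | insert a s ha ih =>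
    obtain ⟨ε, hε, h⟩ := ih
    set S := ∑ b ∈ s, ε b • w b with hS
    -- A sign making the cross term in `‖z • w a + S‖ ^ 2` nonnegative; only its real part enters,
    -- so `1` or `-1` works over both fields.
    have key : ∃ z : 𝕜, ‖z‖ = 1 ∧ 0 ≤ RCLike.re (inner 𝕜 (z • w a) S) := by
      rcases le_total 0 (RCLike.re (inner 𝕜 (w a) S)) with h | h
      · exact ⟨1, by simp, by simpa using h⟩
      · exact ⟨-1, by simp, by simpa using h⟩
    obtain ⟨z, hz, hre⟩ := key
    refine ⟨Function.update ε a z, fun b => ?_, ?_⟩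
    · by_cases hb : b = a
      · subst hb; simp [hz]
      · simpa [hb] using hε b
    · have h1 : ∑ b ∈ s, Function.update ε a z b • w b = S :=
        Finset.sum_congr rfl fun b hb => by
          rw [Function.update_of_ne (ne_of_mem_of_not_mem hb ha)]
      rw [Finset.sum_insert ha, Finset.sum_insert ha, h1, Function.update_self,
        norm_add_sq (𝕜 := 𝕜), norm_smul, hz, one_mul]
      linarith

end SchattenBound

/-! ### The obstruction from finite blocks -/

section Blocks

variable {𝕜 : Type*} [RCLike 𝕜] {H : Type*} [NormedAddCommGroup H] [InnerProductSpace 𝕜 H]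
  [CompleteSpace H] {X Y : Type*} [NormedAddCommGroup X] [NormedSpace 𝕜 X]
  [NormedAddCommGroup Y] [NormedSpace 𝕜 Y] {κ : Type*} [Fintype κ]

/-- An operator from an `ℓ∞`-type block into a Hilbert space has Hilbert-Schmidt sum at most `‖A‖ ^
2`: signs chosen by `exists_signs_sum_norm_sq_le` give a vector of norm at most one. -/
theorem exists_gramSchmidtBound_of_lp (A : X →L[𝕜] H) (x : κ → X)
    (hx : ∀ ε : κ → 𝕜, (∀ a, ‖ε a‖ ≤ 1) → ‖∑ a, ε a • x a‖ ≤ 1) :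
    ∃ A' : lp (fun _ : κ => 𝕜) 2 →L[𝕜] H, (∀ a, A' (lpBasis 𝕜 κ a) = A (x a)) ∧
      GramSchmidtBound (1 / 2) ‖A‖ A' := by
  classical
  have hsum : ∑ a, ‖A (x a)‖ ^ 2 ≤ ‖A‖ ^ 2 := by
    obtain ⟨ε, hε, h⟩ := exists_signs_sum_norm_sq_le (𝕜 := 𝕜) Finset.univ fun a => A (x a)
    refine h.trans (pow_le_pow_left₀ (norm_nonneg _) ?_ 2)
    have : ∑ a, ε a • A (x a) = A (∑ a, ε a • x a) := by simp
    rw [this]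
    exact (A.le_opNorm _).trans (mul_le_of_le_one_right (norm_nonneg _) (hx ε hε))
  obtain ⟨A', hA', -⟩ := exists_clm_of_lp (𝕜 := 𝕜) (y := fun a => A (x a)) (norm_nonneg A)
    (Summable.of_finite) (by rwa [tsum_fintype])
  have hAe : ∀ a, A' (lpBasis 𝕜 κ a) = A (x a) := fun a => by
    refine (hA' _).unique ?_
    convert hasSum_ite_eq a (A (x a)) using 2 with b
    rw [lpBasis_apply, lp.single_apply, Pi.single_apply]
    split_ifs with h
    · rw [h, one_smul]
    · rw [zero_smul]
  refine ⟨A', hAe, .of_basis (lpBasis 𝕜 κ) (norm_nonneg _) .of_finite ?_⟩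
  rw [tsum_fintype]
  simpa only [hAe] using hsum

/-- Each of the coordinates `φ a ∘L B` has norm at most `‖B‖`, so the Hilbert-Schmidt norm is at
most `√(card κ) * ‖B‖`. -/
theorem exists_gramSchmidtBound_to_lp (B : H →L[𝕜] Y) (φ : κ → Y →L[𝕜] 𝕜) (hφ : ∀ a, ‖φ a‖ ≤ 1) :
    ∃ B' : H →L[𝕜] lp (fun _ : κ => 𝕜) 2, (∀ z a, B' z a = φ a (B z)) ∧
      GramSchmidtBound (1 / 2) (√(Fintype.card κ) * ‖B‖) B' := by
  classical
  have hle : ∀ a, ‖φ a ∘L B‖ ≤ ‖B‖ := fun a =>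
    ((φ a).opNorm_comp_le B).trans (mul_le_of_le_one_left (norm_nonneg _) (hφ a))
  have hC : 0 ≤ √(Fintype.card κ) * ‖B‖ := by positivity
  have hsq : (√(Fintype.card κ) * ‖B‖) ^ 2 = ∑ _a : κ, ‖B‖ ^ 2 := by
    rw [mul_pow, Real.sq_sqrt (by positivity)]
    simp
  obtain ⟨B', hB', -⟩ := exists_clm_to_lp (φ := fun a => φ a ∘L B) hC .of_finite (by
    rw [tsum_fintype, hsq]
    exact Finset.sum_le_sum fun a _ => pow_le_pow_left₀ (norm_nonneg _) (hle a) 2)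
  refine ⟨B', fun z a => hB' z a, .of_adjoint_basis (lpBasis 𝕜 κ) hC .of_finite ?_⟩
  rw [tsum_fintype, hsq]
  refine Finset.sum_le_sum fun a _ => pow_le_pow_left₀ (norm_nonneg _) ?_ 2
  set z := B'.adjoint (lpBasis 𝕜 κ a) with hz
  have h1 : ‖z‖ ^ 2 ≤ ‖B‖ * ‖z‖ := by
    have h2 : inner 𝕜 z z = (φ a ∘L B) z := by
      conv_lhs => rw [hz, ContinuousLinearMap.adjoint_inner_left, lpBasis_apply, inner_single_one]
      exact hB' z a
    have h3 := congrArg norm h2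
    rw [inner_self_eq_norm_sq_to_K, norm_pow, RCLike.norm_ofReal, abs_norm] at h3
    rw [h3]
    exact ((φ a ∘L B).le_opNorm z).trans (mul_le_mul_of_nonneg_right (hle a) (norm_nonneg _))
  rcases (norm_nonneg z).eq_or_lt with h0 | h0
  · rw [← h0]; exact norm_nonneg _
  · rw [sq] at h1
    exact le_of_mul_le_mul_right h1 h0

/-- An operator which acts as `c` times a unitary matrix on a finite block of unit vectors of
`ℓ∞`-type does not have a good Schatten class factorization. -/
theorem card_mul_rpow_le_of_factorization {t C c : ℝ} (ht : 0 ≤ t) (hC : 0 ≤ C) (hc : 0 ≤ c)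
    {U : H →L[𝕜] H} (hU : GramSchmidtBound t C U) (A : X →L[𝕜] H) (B : H →L[𝕜] Y)
    (x : κ → X) (hx : ∀ ε : κ → 𝕜, (∀ a, ‖ε a‖ ≤ 1) → ‖∑ a, ε a • x a‖ ≤ 1)
    (φ : κ → Y →L[𝕜] 𝕜) (hφ : ∀ a, ‖φ a‖ ≤ 1) {f : κ → lp (fun _ : κ => 𝕜) 2}
    (hf : Orthonormal 𝕜 f) (hT : ∀ a b, φ b ((B ∘L U ∘L A) (x a)) = c * f a b) :
    (Fintype.card κ : ℝ) ^ (t + 1) * c ≤ √(Fintype.card κ) * (‖B‖ * C * ‖A‖) := by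
  obtain ⟨A', hA', hAb⟩ := exists_gramSchmidtBound_of_lp A x hx
  obtain ⟨B', hB', hBb⟩ := exists_gramSchmidtBound_to_lp B φ hφ
  have hW := (hAb.comp (by norm_num) ht (norm_nonneg _) hC hU).comp (by positivity) (by norm_num)
    (by positivity) (by positivity) hBb
  have hτ : 1 / 2 + (t + 1 / 2) = t + 1 := by ring
  rw [hτ] at hW
  -- The composite `B' U A'` is `c` times a unitary map of `ℓ²(κ)`, so each of its `card κ` singular
  -- numbers is `c`.
  have key := hW.sum_rpow_le (by positivity) (by positivity) (μ := fun _ : κ => c) (fun _ => hc)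
    (lpBasis 𝕜 κ).orthonormal hf (fun a => by
      ext b
      rw [ContinuousLinearMap.comp_apply, ContinuousLinearMap.comp_apply, hB', hA', lp.coeFn_smul,
        Pi.smul_apply, smul_eq_mul]
      exact hT a b) Finset.univ
  rw [Finset.sum_const, Finset.card_univ, nsmul_eq_mul] at key
  have h1 := Real.rpow_le_rpow (by positivity) key (z := t + 1) (by positivity)
  rw [Real.mul_rpow (by positivity) (by positivity), ← Real.rpow_mul hc,
    ← Real.rpow_mul (by positivity), one_div_mul_cancel (by positivity), Real.rpow_one,
    Real.rpow_one] at h1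
  linarith

end Blocks

/-! ### Hadamard matrices -/

section Hadamard

variable (𝕜 : Type*) [RCLike 𝕜]

/-- The normalized Sylvester-Hadamard matrix of order `2 ^ i`. -/
def hadamardMatrix (i : ℕ) : Matrix (Fin i → Bool) (Fin i → Bool) 𝕜 :=
  fun a b => (((√(2 ^ i))⁻¹ * ∏ l, if a l && b l then -1 else 1 : ℝ) : 𝕜)

theorem norm_hadamardMatrix_apply (i : ℕ) (a b : Fin i → Bool) :
    ‖hadamardMatrix 𝕜 i a b‖ = (√(2 ^ i))⁻¹ := by
  rw [hadamardMatrix, RCLike.norm_ofReal, abs_mul, Finset.abs_prod, Finset.prod_eq_one, mul_one,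
    abs_of_nonneg (by positivity)]
  intro l _
  split_ifs <;> simp

/-- The matrix is a tensor power: the inner product of two columns is a product over bits, with
factor `2` where the bits agree and `0` where they differ. -/
theorem hadamardMatrix_mem_unitary (i : ℕ) :
    hadamardMatrix 𝕜 i ∈ Matrix.unitaryGroup (Fin i → Bool) 𝕜 := by
  rw [Matrix.mem_unitaryGroup_iff']
  ext a a'
  have h1 : ∀ b, star (hadamardMatrix 𝕜 i b a) * hadamardMatrix 𝕜 i b a' =
      (((2 ^ i : ℝ)⁻¹ * ∏ l, ((if b l && a l then -1 else 1) *
        (if b l && a' l then -1 else 1)) : ℝ) : 𝕜) := fun b => by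
    rw [hadamardMatrix, hadamardMatrix, RCLike.star_def, RCLike.conj_ofReal, ← RCLike.ofReal_mul,
      Finset.prod_mul_distrib]
    congr 1
    have : (√(2 ^ i : ℝ))⁻¹ * (√(2 ^ i : ℝ))⁻¹ = (2 ^ i : ℝ)⁻¹ := by
      rw [← mul_inv, Real.mul_self_sqrt (by positivity)]
    rw [← this]
    ring
  have h2 : ∑ b : Fin i → Bool, ∏ l, (((if b l && a l then -1 else 1) *
        (if b l && a' l then -1 else 1)) : ℝ) =
      ∏ l, ∑ x : Bool, (((if x && a l then -1 else 1) * (if x && a' l then -1 else 1)) : ℝ) := by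
    rw [Finset.prod_univ_sum, Fintype.piFinset_univ]
  have h3 : ∀ l, ∑ x : Bool, (((if x && a l then -1 else 1) * (if x && a' l then -1 else 1)) : ℝ)
      = if a l = a' l then 2 else 0 := fun l => by
    cases a l <;> cases a' l <;> norm_num
  rw [Matrix.mul_apply]
  simp only [Matrix.star_apply, h1]
  rw [← RCLike.ofReal_sum, ← Finset.mul_sum, h2]
  simp only [h3]
  by_cases h : a = a'
  · subst h
    simp
  · obtain ⟨l, hl⟩ := Function.ne_iff.1 h
    rw [Finset.prod_eq_zero (Finset.mem_univ l) (if_neg hl), mul_zero, Matrix.one_apply_ne h,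
      RCLike.ofReal_zero]

variable {𝕜}

theorem exists_orthonormal_of_mem_unitaryGroup {κ : Type*} [Fintype κ] [DecidableEq κ]
    {M : Matrix κ κ 𝕜} (hM : M ∈ Matrix.unitaryGroup κ 𝕜) :
    ∃ f : κ → lp (fun _ : κ => 𝕜) 2, Orthonormal 𝕜 f ∧ ∀ a b, f a b = M b a := by
  refine ⟨fun a => ⟨fun b => M b a, Memℓp.all _⟩, ?_, fun a b => rfl⟩
  rw [orthonormal_iff_ite]
  intro a a'
  rw [lp.inner_eq_tsum, tsum_fintype]
  have h := congrFun (congrFun (Matrix.mem_unitaryGroup_iff'.1 hM) a) a'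
  rw [Matrix.mul_apply, Matrix.one_apply] at h
  rw [← h]
  exact Finset.sum_congr rfl fun b _ => mul_comm _ _

end Hadamard

/-! ### Nuclear operators from countable series -/

section NuclearSeries

variable {𝕜 : Type*} [RCLike 𝕜] {X Y : Type*}
  [NormedAddCommGroup X] [NormedSpace 𝕜 X] [NormedAddCommGroup Y] [NormedSpace 𝕜 Y]
  [CompleteSpace Y]

theorem summable_of_summable_rpow {ι : Type*} {u : ι → ℝ} (hu : ∀ i, 0 ≤ u i) {s : ℝ} (hs0 : 0 < s)
    (hs1 : s ≤ 1) (h : Summable fun i => u i ^ s) : Summable u := by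
  have h1 : Memℓp u (ENNReal.ofReal s) := memℓp_gen (by
    simpa [ENNReal.toReal_ofReal hs0.le, abs_of_nonneg (hu _)] using h)
  have h2 := (h1.of_exponent_ge (p := 1) (by simpa using hs1)).summable (by simp)
  simpa [abs_of_nonneg (hu _)] using h2

/-- A countable series of rank one operators which defines an `s`-nuclear operator. -/
theorem exists_isSNuclear_hasSum {ι : Type*} [Countable ι] [Infinite ι] {s : ℝ} (hs0 : 0 < s)
    (hs1 : s ≤ 1) (φ : ι → X →L[𝕜] 𝕜) (y : ι → Y) (h : Summable fun i => (‖φ i‖ * ‖y i‖) ^ s) :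
    ∃ T : X →L[𝕜] Y, IsSNuclear s T ∧ ∀ x, HasSum (fun i => φ i x • y i) (T x) := by
  have h1 : Summable fun i => (φ i).smulRight (y i) := by
    refine .of_norm ?_
    simp only [ContinuousLinearMap.norm_smulRight_apply]
    exact summable_of_summable_rpow (fun i => by positivity) hs0 hs1 h
  have h2 : ∀ x, HasSum (fun i => φ i x • y i) ((∑' i, (φ i).smulRight (y i)) x) := fun x =>
    h1.hasSum.mapL (ContinuousLinearMap.apply 𝕜 Y x)
  obtain ⟨e⟩ : Nonempty (ι ≃ ℕ) := by
    obtain ⟨_⟩ := nonempty_denumerable ι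
    exact ⟨Denumerable.eqv ι⟩
  refine ⟨_, ⟨fun n => φ (e.symm n), fun n => y (e.symm n), ?_, fun x =>
    e.symm.hasSum_iff.2 (h2 x)⟩, h2⟩
  simp only [← Real.mul_rpow (norm_nonneg _) (norm_nonneg _)]
  exact e.symm.summable_iff.2 h

end NuclearSeries

/-! ### The block diagonal example -/

section Sharpness

/-- The disjoint union of index sets of cardinalities `2 ^ i`. -/
abbrev BlockIndex : Type := Σ i : ℕ, (Fin i → Bool)

instance : Infinite BlockIndex :=
  Infinite.of_injective (fun i : ℕ => (⟨i, fun _ => true⟩ : BlockIndex)) fun _ _ h =>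
    congrArg Sigma.fst h

variable (𝕜 : Type) [RCLike 𝕜]

/-- The space of bounded families on `BlockIndex`. -/
abbrev BlockSpace : Type := lp (fun _ : BlockIndex => 𝕜) ∞

variable {𝕜}

/-- The unit vectors of `BlockSpace`. -/
def blockVector (a : BlockIndex) : BlockSpace 𝕜 := lp.single ∞ a (1 : 𝕜)

theorem blockVector_apply (a b : BlockIndex) :
    (blockVector a : BlockSpace 𝕜) b = if b = a then 1 else 0 := by
  rw [blockVector, lp.single_apply, Pi.single_apply]

theorem sum_smul_blockVector_apply {i : ℕ} (z : (Fin i → Bool) → 𝕜) (b : BlockIndex) :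
    (∑ a, z a • (blockVector ⟨i, a⟩ : BlockSpace 𝕜)) b =
      ∑ a, if b = ⟨i, a⟩ then z a else 0 := by
  rw [lp.coeFn_sum, Finset.sum_apply]
  refine Finset.sum_congr rfl fun a _ => ?_
  rw [lp.coeFn_smul, Pi.smul_apply, blockVector_apply, smul_eq_mul, mul_ite, mul_one, mul_zero]

theorem sum_smul_blockVector_apply_self {i : ℕ} (z : (Fin i → Bool) → 𝕜) (b : Fin i → Bool) :
    (∑ a, z a • (blockVector ⟨i, a⟩ : BlockSpace 𝕜)) ⟨i, b⟩ = z b := by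
  rw [sum_smul_blockVector_apply]
  simp

theorem norm_sum_smul_blockVector_le {i : ℕ} {z : (Fin i → Bool) → 𝕜} {C : ℝ} (hC : 0 ≤ C)
    (hz : ∀ a, ‖z a‖ ≤ C) : ‖∑ a, z a • (blockVector ⟨i, a⟩ : BlockSpace 𝕜)‖ ≤ C := by
  refine lp.norm_le_of_forall_le hC fun b => ?_
  by_cases h : ∃ a, b = ⟨i, a⟩
  · obtain ⟨a, rfl⟩ := h
    rw [sum_smul_blockVector_apply_self]
    exact hz a
  · push Not at h
    rw [sum_smul_blockVector_apply]
    simp only [h, if_false, Finset.sum_const_zero, norm_zero]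
    exact hC

theorem norm_evalCLM_le (b : BlockIndex) :
    ‖lp.evalCLM 𝕜 (fun _ : BlockIndex => 𝕜) ∞ b‖ ≤ 1 :=
  LinearMap.mkContinuous_norm_le _ zero_le_one _

/-- The factor by which the `s`-nuclear example acts on the `i`-th block. -/
def blockScale (s : ℝ) (i : ℕ) : ℝ :=
  (2 ^ i : ℝ) ^ (1 / 2 - 1 / s) * ((i : ℝ) + 1) ^ (-2 / s)

theorem blockScale_nonneg (s : ℝ) (i : ℕ) : 0 ≤ blockScale s i := by
  unfold blockScale
  positivity

theorem prod_blockScale {n : ℕ} (s : Fin n → ℝ) (i : ℕ) :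
    ∏ k, blockScale (s k) i =
      (2 ^ i : ℝ) ^ ((n : ℝ) / 2 - ∑ k, 1 / s k) * ((i : ℝ) + 1) ^ (-2 * ∑ k, 1 / s k) := by
  simp only [blockScale]
  rw [Finset.prod_mul_distrib, ← Real.rpow_sum_of_pos (by positivity),
    ← Real.rpow_sum_of_pos (by positivity), Finset.sum_sub_distrib, Finset.mul_sum]
  simp [div_eq_mul_inv]

/-- Each of the `2 ^ i` terms of block `i` equals `2 ^ (-i) * (i + 1) ^ (-2)`, so the block
contributes `(i + 1) ^ (-2)`. The scale is of the largest power of `2 ^ i` for which this works, up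
to the polynomial correction. -/
theorem summable_blockScale {s : ℝ} (hs : 0 < s) :
    Summable fun a : BlockIndex => (blockScale s a.1 * (√(2 ^ a.1))⁻¹) ^ s := by
  have h1 : ∀ i : ℕ, (blockScale s i * (√(2 ^ i))⁻¹) ^ s = (2 ^ i : ℝ)⁻¹ * (((i : ℝ) + 1) ^ 2)⁻¹ :=
    fun i => by
      have h2 : (√(2 ^ i : ℝ))⁻¹ = (2 ^ i : ℝ) ^ (-1 / 2 : ℝ) := by
        rw [Real.sqrt_eq_rpow, ← Real.rpow_neg (by positivity)]
        norm_num
      have h3 : blockScale s i * (√(2 ^ i))⁻¹ =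
          (2 ^ i : ℝ) ^ (-1 / s) * ((i : ℝ) + 1) ^ (-2 / s) := by
        have : (-1 / s : ℝ) = (1 / 2 - 1 / s) + (-1 / 2) := by ring
        rw [blockScale, h2, this, Real.rpow_add (by positivity)]
        ring
      rw [h3, Real.mul_rpow (by positivity) (by positivity), ← Real.rpow_mul (by positivity),
        ← Real.rpow_mul (by positivity), div_mul_cancel₀ _ hs.ne', div_mul_cancel₀ _ hs.ne',
        Real.rpow_neg_one, Real.rpow_neg (by positivity), Real.rpow_two]
  simp only [h1]
  rw [summable_sigma_of_nonneg (fun a => by positivity)]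
  refine ⟨fun i => .of_finite, ?_⟩
  simp only [tsum_fintype, Finset.sum_const, Finset.card_univ, Fintype.card_fun, Fintype.card_bool,
    Fintype.card_fin, nsmul_eq_mul, Nat.cast_pow, Nat.cast_ofNat]
  have h4 := (summable_nat_add_iff 1).2 (Real.summable_nat_pow_inv (p := 2) |>.2 one_lt_two)
  refine h4.congr fun i => ?_
  push_cast
  rw [mul_inv_cancel_left₀ (by positivity)]

/-- A block diagonal `s`-nuclear operator with multiples of Hadamard matrices as blocks. -/
theorem exists_isSNuclear_hadamard {s : ℝ} (hs0 : 0 < s) (hs1 : s ≤ 1) :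
    ∃ T : BlockSpace 𝕜 →L[𝕜] BlockSpace 𝕜, IsSNuclear s T ∧ ∀ (i : ℕ) (a : Fin i → Bool),
      T (blockVector ⟨i, a⟩) = ∑ b, ((blockScale s i : 𝕜) * hadamardMatrix 𝕜 i b a) •
        blockVector ⟨i, b⟩ := by
  set y : BlockIndex → BlockSpace 𝕜 := fun a =>
    ∑ b, ((blockScale s a.1 : 𝕜) * hadamardMatrix 𝕜 a.1 b a.2) • blockVector ⟨a.1, b⟩ with hy
  have hyn : ∀ a, ‖y a‖ ≤ blockScale s a.1 * (√(2 ^ a.1))⁻¹ := fun a => by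
    have := blockScale_nonneg s a.1
    refine norm_sum_smul_blockVector_le (by positivity) fun b => ?_
    rw [norm_mul, norm_hadamardMatrix_apply, RCLike.norm_ofReal, abs_of_nonneg this]
  obtain ⟨T, hT, hsum⟩ := exists_isSNuclear_hasSum hs0 hs1
    (fun a => lp.evalCLM 𝕜 (fun _ : BlockIndex => 𝕜) ∞ a) y
    ((summable_blockScale hs0).of_nonneg_of_le (fun a => by positivity) fun a => by
      refine Real.rpow_le_rpow (by positivity) ?_ hs0.le
      exact (mul_le_of_le_one_left (norm_nonneg _) (norm_evalCLM_le a)).trans (hyn a))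
  refine ⟨T, hT, fun i a => (hsum _).unique ?_⟩
  have key : ∀ b, lp.evalCLM 𝕜 (fun _ : BlockIndex => 𝕜) ∞ b (blockVector ⟨i, a⟩) • y b =
      if b = ⟨i, a⟩ then y ⟨i, a⟩ else 0 := fun b => by
    have : lp.evalCLM 𝕜 (fun _ : BlockIndex => 𝕜) ∞ b (blockVector ⟨i, a⟩) =
      if b = ⟨i, a⟩ then 1 else 0 := blockVector_apply _ _
    rw [this]
    split_ifs with h
    · rw [h, one_smul]
    · rw [zero_smul]
  simp only [key]
  exact hasSum_ite_eq _ _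

/-- All factors use the same matrix on a block, so the product is a scalar times a power of it,
which is again unitary. -/
theorem partialProduct_hadamard {n : ℕ} {T : Fin n → BlockSpace 𝕜 →L[𝕜] BlockSpace 𝕜}
    {c : Fin n → 𝕜} {i : ℕ} (hT : ∀ k a, T k (blockVector ⟨i, a⟩) =
      ∑ b, (c k * hadamardMatrix 𝕜 i b a) • blockVector ⟨i, b⟩) (j : Fin (n + 1))
    (a : Fin i → Bool) :
    partialProduct (X := fun _ => BlockSpace 𝕜) T j (blockVector ⟨i, a⟩) =
      ∑ b, ((∏ k with Fin.castSucc k < j, c k) * (hadamardMatrix 𝕜 i ^ (j : ℕ)) b a) •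
        blockVector ⟨i, b⟩ := by
  induction j using Fin.induction with
  | zero =>
    rw [partialProduct_zero]
    simp [Matrix.one_apply, ite_smul]
  | succ k ih =>
    have hfil : (Finset.univ.filter fun i : Fin n => i.castSucc < k.succ) =
        insert k (Finset.univ.filter fun i : Fin n => i.castSucc < k.castSucc) := by
      ext i
      simp only [Finset.mem_filter, Finset.mem_univ, true_and, Finset.mem_insert, Fin.lt_def,
        Fin.val_castSucc, Fin.val_succ, Fin.ext_iff]
      omega
    have hk : k ∉ Finset.univ.filter fun i : Fin n => i.castSucc < k.castSucc := by simp
    rw [hfil, Finset.prod_insert hk, partialProduct_succ, ContinuousLinearMap.comp_apply, ih,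
      map_sum, Fin.val_succ, pow_succ']
    simp only [map_smul, hT, Finset.smul_sum, smul_smul, Fin.val_castSucc]
    rw [Finset.sum_comm]
    refine Finset.sum_congr rfl fun b _ => ?_
    rw [← Finset.sum_smul, Matrix.mul_apply, Finset.mul_sum]
    congr 1
    refine Finset.sum_congr rfl fun d _ => ?_
    ring

theorem not_forall_two_pow_rpow_le {θ : ℝ} (hθ : 0 < θ) (K q : ℝ) :
    ¬ ∀ i : ℕ, (2 ^ i : ℝ) ^ θ ≤ K * ((i : ℝ) + 1) ^ q := by
  intro h
  obtain ⟨k, hk⟩ := exists_nat_ge q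
  have hb : 1 < (2 : ℝ) ^ θ := Real.one_lt_rpow one_lt_two hθ
  have hlim := ((tendsto_pow_const_div_const_pow_of_one_lt k hb).comp
    (Filter.tendsto_add_atTop_nat 1)).const_mul (|K| * 2 ^ θ)
  rw [mul_zero] at hlim
  refine absurd (ge_of_tendsto hlim (b := 1) (.of_forall fun i => ?_)) (by norm_num)
  have hi : (1 : ℝ) ≤ (i : ℝ) + 1 := by
    have : (0 : ℝ) ≤ i := Nat.cast_nonneg i
    linarith
  have h1 : ((2 : ℝ) ^ θ) ^ i ≤ |K| * ((i : ℝ) + 1) ^ k := by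
    have h2 : ((2 : ℝ) ^ θ) ^ i = (2 ^ i : ℝ) ^ θ := by
      rw [← Real.rpow_natCast, ← Real.rpow_natCast, ← Real.rpow_mul zero_le_two,
        ← Real.rpow_mul zero_le_two, mul_comm]
    rw [h2, ← Real.rpow_natCast ((i : ℝ) + 1)]
    refine (h i).trans ?_
    gcongr
    · exact le_abs_self K
  have hp : 0 < (2 : ℝ) ^ θ := by positivity
  simp only [Function.comp_apply, Nat.cast_add, Nat.cast_one, pow_succ]
  rw [mul_div_assoc', le_div_iff₀ (by positivity)]
  nlinarith

/-- The product of the block diagonal examples does not factor through a smaller Schatten class. -/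
theorem not_factorsThroughSchatten_hadamard {n : ℕ} {s : Fin n → ℝ}
    {T : Fin n → BlockSpace 𝕜 →L[𝕜] BlockSpace 𝕜} (hT : ∀ k i a, T k (blockVector ⟨i, a⟩) =
      ∑ b, ((blockScale (s k) i : 𝕜) * hadamardMatrix 𝕜 i b a) • blockVector ⟨i, b⟩)
    {H : Type*} [NormedAddCommGroup H] [InnerProductSpace 𝕜 H] [CompleteSpace H]
    {p r : ℝ≥0∞} (hr : r⁻¹ = ENNReal.ofReal ((∑ k, 1 / s k) - ((n : ℝ) + 1) / 2))
    (hp0 : 0 < p) (hpr : p < r) :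
    ¬ FactorsThroughSchatten H p (operatorProduct (X := fun _ => BlockSpace 𝕜) T) := by
  rintro ⟨A, U, B, hU, hfac⟩
  have hpt : p ≠ ⊤ := hpr.ne_top
  have hp : 0 < p.toReal := ENNReal.toReal_pos hp0.ne' hpt
  obtain ⟨μ, hμ, hμs⟩ := hU.2 hpt
  obtain ⟨C, hC, hb⟩ := gramSchmidtBound_of_isSingularSeq hμ hp hμs
  set S := ∑ k, 1 / s k with hS
  set t := 1 / p.toReal with ht
  have htr : S - ((n : ℝ) + 1) / 2 < t := by
    have h1 := ENNReal.inv_lt_inv.2 hpr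
    rw [hr, ← ENNReal.ofReal_toReal (ENNReal.inv_ne_top.2 hp0.ne'), ENNReal.toReal_inv,
      ENNReal.ofReal_lt_ofReal_iff (by positivity)] at h1
    rwa [ht, one_div]
  refine not_forall_two_pow_rpow_le (sub_pos.2 htr) (‖B‖ * C * ‖A‖) (2 * S) fun i => ?_
  obtain ⟨f, hf, hfM⟩ := exists_orthonormal_of_mem_unitaryGroup
    (pow_mem (hadamardMatrix_mem_unitary 𝕜 i) n)
  have hΛ : 0 ≤ ∏ k, blockScale (s k) i := Finset.prod_nonneg fun k _ => blockScale_nonneg _ _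
  have key := card_mul_rpow_le_of_factorization (by positivity) hC hΛ hb A B
    (fun a : Fin i → Bool => blockVector ⟨i, a⟩)
    (fun ε hε => norm_sum_smul_blockVector_le zero_le_one hε)
    (fun b => lp.evalCLM 𝕜 (fun _ : BlockIndex => 𝕜) ∞ ⟨i, b⟩) (fun b => norm_evalCLM_le _) hf
    (fun a b => by
      rw [← hfac, operatorProduct, partialProduct_hadamard (fun k a => hT k i a), hfM]
      refine (sum_smul_blockVector_apply_self _ b).trans ?_
      simp [Fin.castSucc_lt_last])
  rw [prod_blockScale] at key
  simp only [Fintype.card_fun, Fintype.card_bool, Fintype.card_fin, Nat.cast_pow,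
    Nat.cast_ofNat] at key
  set m : ℝ := 2 ^ i with hm
  have hm0 : 0 < m := by positivity
  set l : ℝ := (i : ℝ) + 1 with hl
  have hl0 : 0 < l := by positivity
  -- The exponents match since `t + 1 + n / 2 - S = 1 / 2 + (t - (S - (n + 1) / 2))`. The half
  -- cancels against `√m`, leaving a positive power of `m` bounded by a power of `l`.
  have e1 : m ^ (t + 1) * (m ^ ((n : ℝ) / 2 - S) * l ^ (-2 * S)) =
      √m * (m ^ (t - (S - ((n : ℝ) + 1) / 2)) * (l ^ (2 * S))⁻¹) := by
    rw [← mul_assoc, ← mul_assoc, ← Real.rpow_add hm0, Real.sqrt_eq_rpow, ← Real.rpow_add hm0,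
      ← Real.rpow_neg hl0.le]
    congr 2
    · ring
    · ring
  rw [e1] at key
  have h2 := le_of_mul_le_mul_left key (Real.sqrt_pos.2 hm0)
  rwa [← div_eq_mul_inv, div_le_iff₀ (Real.rpow_pos_of_pos hl0 _)] at h2

end Sharpness

end

/-- As `1 / s k ≥ 1` and `n ≥ 1`, the real number in `hr` is nonnegative, so `ENNReal.ofReal`
truncates nothing; `r = ⊤` exactly when it vanishes. -/
theorem mainTheorem1 {𝕜 : Type} [RCLike 𝕜] (n : ℕ) (hn : 1 ≤ n)
    (s : Fin n → ℝ) (hs : ∀ k, 0 < s k ∧ s k ≤ 1)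
    (r : ℝ≥0∞) (hr : r⁻¹ = ENNReal.ofReal ((∑ k, 1 / s k) - ((n : ℝ) + 1) / 2)) :
    (∀ (H : Type v) [NormedAddCommGroup H] [InnerProductSpace 𝕜 H] [CompleteSpace H],
      ¬ FiniteDimensional 𝕜 H →
      ∀ (X : Fin (n + 1) → Type u) [∀ i, NormedAddCommGroup (X i)]
        [∀ i, NormedSpace 𝕜 (X i)] [∀ i, CompleteSpace (X i)]
        (T : ∀ k : Fin n, X k.castSucc →L[𝕜] X k.succ),
        (∀ k, IsSNuclear (s k) (T k)) →
        FactorsThroughSchatten H r (operatorProduct T) ∧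
        schattenFactorNorm H r (operatorProduct T) ≤ ∏ k, nuclearQuasinorm (s k) (T k)) ∧
    (∃ (X : Fin (n + 1) → Type) (_ : ∀ i, NormedAddCommGroup (X i))
      (_ : ∀ i, NormedSpace 𝕜 (X i)) (_ : ∀ i, CompleteSpace (X i))
      (T : ∀ k : Fin n, X k.castSucc →L[𝕜] X k.succ),
      (∀ k, IsSNuclear (s k) (T k)) ∧
      ∀ (H : Type v) [NormedAddCommGroup H] [InnerProductSpace 𝕜 H] [CompleteSpace H]
        (p : ℝ≥0∞), 0 < p → p < r → ¬ FactorsThroughSchatten H p (operatorProduct T)) := by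
  refine ⟨fun H _ _ _ hH X _ _ _ T hT => operatorProduct_schattenFactorization hH hn hs hT hr, ?_⟩
  choose T hT hTb using fun k => exists_isSNuclear_hadamard (𝕜 := 𝕜) (hs k).1 (hs k).2
  exact ⟨fun _ => BlockSpace 𝕜, fun _ => inferInstance, fun _ => inferInstance,
    fun _ => inferInstance, T, hT, fun H _ _ _ p hp0 hpr =>
    not_factorsThroughSchatten_hadamard hTb hr hp0 hpr⟩
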